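/- Let $(c_n)_{n\ge 1}$ be an unbounded increasing (not necessarily strictly) sequence in $(0,\infty)$. Let $d_n\in M_n=M_n(\mathbb C)$ be the diagonal matrix with $k$th diagonal entry $c_n^k$, $1\le k\le n$. Let $M=\oplus^\infty_n (M_n\oplus M_n)$ be the $C^*$-algebra of bounded sequences of pairs of matrices (operator norm on $M_n$, supremum norm on pairs and sequences), and let $N\subset M$ be the subalgebra of all tuples $((x_n, d_nx_nd_n^{-1}))_n$; its norm is $p((x_n))=\sup_n\max\{\|x_n\|,\|d_nx_nd_n^{-1}\|\}$. Let $L_n$ be the left shift on $\mathbb C^n$ ($L_ne_1=0$, $L_ne_j=e_{j-1}$ for $j\ge2$). For $n\ge k\ge 1$ let $E_{n,k}$ be the set of integers in $[\frac nk,\frac{2n}k]$ and $u_{n,k}=\frac1{|E_{n,k}|}\sum_{i\in E_{n,k}}L_n^i$; for $n<k$ let $u_{n,k}=I_n$. Put $u_k=(u_{n,k})_n$ and $$A=\{a\in N:\ p(au_k-a)+p(u_ka-a)\to0 \text{ as } k\to\infty\}.$$ Then $A$ is a norm-closed subalgebra of $M$ (hence an operator algebra), and: 1. for every $a\in A$ the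 spectrum of $a$ (computed in the algebra obtained from $A$ by adjoining an identity) is either finite, or consists of $0$ and the terms of a sequence of complex numbers converging to $0$; 2. $A$ is semisimple (its Jacobson radical is zero) and approximately unital (it has a two-sided contractive approximate identity); 3. $A$ is a modular annihilator algebra: it is semiprime, every maximal modular left ideal of $A$ has a nonzero right annihilator, and every maximal modular right ideal of $A$ has a nonzero left annihilator; 4. $A$ is not weakly compact: for some $a\in A$ the map $x\mapsto axa$ on $A$ is not a weakly compact operator. -/

import Mathlib

open Filter Topology
open scoped ENNReal Matrix.Norms.L2Operator

/-! ### Banach-algebra notions, for algebras that need not have an identity -/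

namespace BanachAlg

section Algebraic

variable {A : Type*} [NonUnitalRing A] [Module ℂ A]

/-- `J` is a left ideal of the algebra `A`. -/
def IsLeftIdeal (J : Submodule ℂ A) : Prop := ∀ a : A, ∀ x ∈ J, a * x ∈ J

/-- `J` is a right ideal of the algebra `A`. -/
def IsRightIdeal (J : Submodule ℂ A) : Prop := ∀ a : A, ∀ x ∈ J, x * a ∈ J

/-- `J` is a maximal modular left ideal: a proper left ideal, maximal among the proper left ideals,
for which some `e` is a right identity modulo `J`. -/
def IsMaxModularLeftIdeal (J : Submodule ℂ A) : Prop :=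
  IsLeftIdeal J ∧ J ≠ ⊤ ∧ (∀ K : Submodule ℂ A, IsLeftIdeal K → J < K → K = ⊤) ∧
    ∃ e : A, ∀ x : A, x - x * e ∈ J

/-- `J` is a maximal modular right ideal: a proper right ideal, maximal among the proper right
ideals, for which some `e` is a left identity modulo `J`. -/
def IsMaxModularRightIdeal (J : Submodule ℂ A) : Prop :=
  IsRightIdeal J ∧ J ≠ ⊤ ∧ (∀ K : Submodule ℂ A, IsRightIdeal K → J < K → K = ⊤) ∧
    ∃ e : A, ∀ x : A, x - e * x ∈ J

variable (A)

/-- `A` is semisimple: its Jacobson radical, the intersection of all maximal modular left ideals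
(which is `A` if there are none), is zero. -/
def IsSemisimple : Prop :=
  ∀ x : A, (∀ J : Submodule ℂ A, IsMaxModularLeftIdeal J → x ∈ J) → x = 0

/-- `A` is a modular annihilator algebra: it is semiprime, every maximal modular left ideal has a
nonzero right annihilator, and every maximal modular right ideal has a nonzero left annihilator. -/
def IsModularAnnihilator : Prop :=
  (∀ a : A, (∀ x : A, a * x * a = 0) → a = 0) ∧
  (∀ J : Submodule ℂ A, IsMaxModularLeftIdeal J → ∃ b : A, b ≠ 0 ∧ ∀ x ∈ J, x * b = 0) ∧
  (∀ J : Submodule ℂ A, IsMaxModularRightIdeal J → ∃ b : A, b ≠ 0 ∧ ∀ x ∈ J, b * x = 0)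

end Algebraic

section Normed

variable (A : Type*) [NonUnitalNormedRing A] [NormedSpace ℂ A]

/-- `A` has a contractive approximate identity (two-sided). The net is given as a filter. -/
def IsApproximatelyUnital : Prop :=
  ∃ l : Filter A, l.IsApproximateUnit ∧ ∀ᶠ e in l, ‖e‖ ≤ 1

/-- `A` is weakly compact: for every `a`, the map `x ↦ a x a` is a weakly compact operator, that is,
it takes the closed unit ball to a relatively weakly compact set. -/
def IsWeaklyCompact : Prop :=
  ∀ a : A, IsCompact (closure
    ((fun x : A => toWeakSpace ℂ A (a * x * a)) '' Metric.closedBall (0 : A) 1))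

end Normed

end BanachAlg

/-! ### The algebra -/

namespace ShiftAlg

/-- The `n × n` complex matrices, `n ≥ 1`, with the operator norm on the Hilbert space `ℂⁿ`. -/
abbrev Mat (n : ℕ+) : Type := Matrix (Fin n) (Fin n) ℂ

/-- The bounded sequences in `∏ₙ (Mₙ ⊕ Mₙ)`, a C⋆-algebra under the pointwise operations and the
supremum norm, with `‖(x, y)‖ = max ‖x‖ ‖y‖` on `Mₙ ⊕ Mₙ`. -/
abbrev M : Type := lp (fun n : ℕ+ => Mat n × Mat n) ∞

/-- The diagonal matrix `dₙ` with `k`-th diagonal entry `cₙ ^ k`, `1 ≤ k ≤ n`. -/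
noncomputable def d (c : ℕ+ → ℝ) (n : ℕ+) : Mat n :=
  Matrix.diagonal fun i : Fin n => (c n : ℂ) ^ ((i : ℕ) + 1)

/-- The left shift on `ℂⁿ`: `e₁ ↦ 0` and `eⱼ ↦ eⱼ₋₁` for `j ≥ 2`. -/
def shift (n : ℕ+) : Mat n :=
  Matrix.of fun i j : Fin n => if (i : ℕ) + 1 = (j : ℕ) then 1 else 0

/-- The set of integers in the interval `[n / k, 2 n / k]`. -/
def E (n k : ℕ+) : Finset ℕ :=
  Finset.Icc ⌈((n : ℕ) : ℚ) / ((k : ℕ) : ℚ)⌉₊ ⌊2 * ((n : ℕ) : ℚ) / ((k : ℕ) : ℚ)⌋₊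

/-- The matrix `uₙₖ`: the average of the powers of the left shift with exponents in `E n k` if
`k ≤ n`, and the identity matrix if `n < k`. -/
noncomputable def u (n k : ℕ+) : Mat n :=
  if k ≤ n then ((E n k).card : ℂ)⁻¹ • ∑ i ∈ E n k, shift n ^ i else 1

/-- The pair `(uₙₖ, dₙ uₙₖ dₙ⁻¹)`. -/
noncomputable def U (c : ℕ+ → ℝ) (k n : ℕ+) : Mat n × Mat n :=
  (u n k, d c n * u n k * (d c n)⁻¹)

/-- The supremum norm of a sequence of pairs of matrices, as an extended real. For a sequence of
the form `(xₙ, dₙ xₙ dₙ⁻¹)` it is `supₙ max (‖xₙ‖, ‖dₙ xₙ dₙ⁻¹‖)`. -/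
noncomputable def p (x : ∀ n : ℕ+, Mat n × Mat n) : ℝ≥0∞ := ⨆ n, ‖x n‖ₑ

theorem p_le_iff {x : ∀ n : ℕ+, Mat n × Mat n} {b : ℝ≥0∞} : p x ≤ b ↔ ∀ n, ‖x n‖ₑ ≤ b :=
  iSup_le_iff

theorem enorm_le_p (x : ∀ n : ℕ+, Mat n × Mat n) (n : ℕ+) : ‖x n‖ₑ ≤ p x :=
  le_iSup (fun n => ‖x n‖ₑ) n

theorem p_zero : p 0 = 0 := by simp [p]

theorem p_add_le (x y : ∀ n : ℕ+, Mat n × Mat n) : p (x + y) ≤ p x + p y :=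
  p_le_iff.2 fun n => (enorm_add_le _ _).trans (add_le_add (enorm_le_p x n) (enorm_le_p y n))

theorem enorm_mul_le_mul {n : ℕ+} (x y : Mat n × Mat n) : ‖x * y‖ₑ ≤ ‖x‖ₑ * ‖y‖ₑ := by
  simp only [enorm_eq_nnnorm]
  exact_mod_cast nnnorm_mul_le x y

theorem p_mul_le (x y : ∀ n : ℕ+, Mat n × Mat n) : p (x * y) ≤ p x * p y :=
  p_le_iff.2 fun n => (enorm_mul_le_mul _ _).trans (mul_le_mul' (enorm_le_p x n) (enorm_le_p y n))

theorem p_smul_le (r : ℂ) (x : ∀ n : ℕ+, Mat n × Mat n) : p (r • x) ≤ ‖r‖ₑ * p x :=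
  p_le_iff.2 fun n => by
    have h : ‖r • x n‖ₑ ≤ ‖r‖ₑ * ‖x n‖ₑ := by
      simp only [enorm_eq_nnnorm]
      exact_mod_cast nnnorm_smul_le r (x n)
    exact h.trans (mul_le_mul' le_rfl (enorm_le_p x n))

/-- On `M` the extended norm is the norm of `M`. -/
theorem p_coe (a : M) : p (fun n => a n) = ‖a‖ₑ := by
  apply le_antisymm
  · refine p_le_iff.2 fun n => ?_
    simp only [enorm_eq_nnnorm]
    exact_mod_cast lp.norm_apply_le_norm ENNReal.top_ne_zero a n
  · by_cases h : p (fun n => a n) = ∞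
    · rw [h]; exact le_top
    · rw [← ofReal_norm, ← ENNReal.ofReal_toReal h]
      refine ENNReal.ofReal_le_ofReal (lp.norm_le_of_forall_le ENNReal.toReal_nonneg fun n => ?_)
      rw [← toReal_enorm]
      exact ENNReal.toReal_mono h (enorm_le_p (fun n => a n) n)

theorem d_conj_mul (c : ℕ+ → ℝ) (n : ℕ+) (x y : Mat n) :
    d c n * (x * y) * (d c n)⁻¹ = (d c n * x * (d c n)⁻¹) * (d c n * y * (d c n)⁻¹) := by
  by_cases h : c n = 0
  · have h0 : d c n = 0 := by
      ext i j
      by_cases hij : i = j <;> simp [d, h, hij]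
    simp [h0]
  · have hu : IsUnit (d c n).det := by
      rw [d, Matrix.det_diagonal, isUnit_iff_ne_zero]
      exact Finset.prod_ne_zero_iff.2 fun i _ => pow_ne_zero _ (by exact_mod_cast h)
    have h1 : (d c n)⁻¹ * d c n = 1 := Matrix.nonsing_inv_mul _ hu
    calc d c n * (x * y) * (d c n)⁻¹
        = d c n * x * 1 * y * (d c n)⁻¹ := by simp only [mul_one, mul_assoc]
      _ = _ := by rw [← h1]; simp only [mul_assoc]

/-- The algebra of the bounded sequences of the form `(xₙ, dₙ xₙ dₙ⁻¹)`. -/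
noncomputable def N (c : ℕ+ → ℝ) : NonUnitalSubalgebra ℂ M where
  carrier := {a | ∀ n, (a n).2 = d c n * (a n).1 * (d c n)⁻¹}
  add_mem' {a b} ha hb n := by
    simp [ha n, hb n, mul_add, add_mul]
  zero_mem' n := by simp
  mul_mem' {a b} ha hb n := by
    simp only [lp.infty_coeFn_mul, Pi.mul_apply, Prod.snd_mul, Prod.fst_mul, ha n, hb n, d_conj_mul]
  smul_mem' r a ha n := by
    simp [lp.coeFn_smul, ha n]

/-- `p (a uₖ - a) + p (uₖ a - a)`. -/
noncomputable def defect (c : ℕ+ → ℝ) (a : M) (k : ℕ+) : ℝ≥0∞ :=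
  p (fun n => a n * U c k n - a n) + p (fun n => U c k n * a n - a n)

/-- The algebra of all `a ∈ N` such that `p (a uₖ - a) + p (uₖ a - a) → 0` as `k → ∞`. -/
noncomputable def A (c : ℕ+ → ℝ) : NonUnitalSubalgebra ℂ M where
  carrier := {a | a ∈ N c ∧ Tendsto (defect c a) atTop (𝓝 0)}
  add_mem' {a b} ha hb := by
    refine ⟨add_mem ha.1 hb.1, ?_⟩
    have h := ha.2.add hb.2
    rw [add_zero] at h
    refine tendsto_of_tendsto_of_tendsto_of_le_of_le tendsto_const_nhds h
      (fun k => zero_le) fun k => ?_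
    have e1 : (fun n => (a + b : M) n * U c k n - (a + b : M) n) =
        (fun n => a n * U c k n - a n) + fun n => b n * U c k n - b n := by
      funext n; simp only [lp.coeFn_add, Pi.add_apply, add_mul]; abel
    have e2 : (fun n => U c k n * (a + b : M) n - (a + b : M) n) =
        (fun n => U c k n * a n - a n) + fun n => U c k n * b n - b n := by
      funext n; simp only [lp.coeFn_add, Pi.add_apply, mul_add]; abel
    simp only [defect, e1, e2]
    refine (add_le_add (p_add_le _ _) (p_add_le _ _)).trans (le_of_eq ?_)
    abel
  zero_mem' := by
    refine ⟨zero_mem _, ?_⟩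
    have : defect c 0 = fun _ => 0 := by
      funext k; simp [defect, p]
    rw [this]; exact tendsto_const_nhds
  mul_mem' {a b} ha hb := by
    refine ⟨mul_mem ha.1 hb.1, ?_⟩
    have h1 := ENNReal.Tendsto.const_mul (a := ‖a‖ₑ) hb.2 (Or.inr enorm_ne_top)
    have h2 := ENNReal.Tendsto.const_mul (a := ‖b‖ₑ) ha.2 (Or.inr enorm_ne_top)
    have h := h1.add h2
    simp only [mul_zero, add_zero] at h
    refine tendsto_of_tendsto_of_tendsto_of_le_of_le tendsto_const_nhds h
      (fun k => zero_le) fun k => ?_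
    have e1 : (fun n => (a * b : M) n * U c k n - (a * b : M) n) =
        (fun n => a n) * fun n => b n * U c k n - b n := by
      funext n; simp only [lp.infty_coeFn_mul, Pi.mul_apply, mul_sub, mul_assoc]
    have e2 : (fun n => U c k n * (a * b : M) n - (a * b : M) n) =
        (fun n => U c k n * a n - a n) * fun n => b n := by
      funext n; simp only [lp.infty_coeFn_mul, Pi.mul_apply, sub_mul, mul_assoc]
    simp only [defect, e1, e2]
    refine add_le_add ((p_mul_le _ _).trans ?_) ((p_mul_le _ _).trans ?_)
    · rw [p_coe]; gcongr; exact le_self_add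
    · rw [p_coe, mul_comm]; gcongr; exact le_add_self
  smul_mem' r a ha := by
    refine ⟨SMulMemClass.smul_mem r ha.1, ?_⟩
    have h := ENNReal.Tendsto.const_mul (a := ‖r‖ₑ) ha.2 (Or.inr enorm_ne_top)
    rw [mul_zero] at h
    refine tendsto_of_tendsto_of_tendsto_of_le_of_le tendsto_const_nhds h
      (fun k => zero_le) fun k => ?_
    have e1 : (fun n => (r • a : M) n * U c k n - (r • a : M) n) =
        r • fun n => a n * U c k n - a n := by
      funext n; simp only [lp.coeFn_smul, Pi.smul_apply, smul_sub, smul_mul_assoc]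
    have e2 : (fun n => U c k n * (r • a : M) n - (r • a : M) n) =
        r • fun n => U c k n * a n - a n := by
      funext n; simp only [lp.coeFn_smul, Pi.smul_apply, smul_sub, mul_smul_comm]
    simp only [defect, e1, e2]
    rw [mul_add]
    exact add_le_add (p_smul_le _ _) (p_smul_le _ _)

noncomputable instance (c : ℕ+ → ℝ) : NormedSpace ℂ (A c) where
  norm_smul_le r x := norm_smul_le r (x : M)

end ShiftAlg

/-! Write the blocks of `a ∈ A` as `(xₙ, yₙ)` with `yₙ = dₙ xₙ dₙ⁻¹`; the two components are
similar, hence have the same spectrum. Conjugation by `dₙ` turns `Lₙ` into `cₙ⁻¹ Lₙ`, so for `n ≥ k`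
and `cₙ ≥ 2` the second component of `uₖ` has norm at most `1/2`. As `a uₖ` is close to `a`, this
forces `yₙ → 0` (`exists_norm_snd_le`), and only finitely many blocks have eigenvalues of modulus at
least a given `δ > 0`.

To pass from blocks to `A` one needs a bound on `(1 + xₙ)⁻¹` uniform in `n`, although `xₙ` need not
be small (`exists_inv_one_add_of_band`). Boundedness of `yₙ` makes the part of `xₙ` below the
diagonal `O(1/cₙ)`. The upper triangular part is close to its product with `uₙₖ`, which lives at
distance at least `n/k` above the diagonal, and such a product is nilpotent of order `k`, whatever
`n` is. Hence `1 + a` is invertible modulo finitely many blocks, and blockwise invertibility yields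
a quasi-inverse in `A` (`isQuasiregular_of_isUnit`). This gives the spectral statement, the spectrum
in the unitization being `quasispectrum`. It also shows that a proper modular one-sided ideal cannot
contain all blocks, so annihilators come from a single matrix algebra (`exists_right_annihilator`,
`exists_left_annihilator`).

The `uₖ` themselves lie in `A` because long averages of powers of a contraction are almost invariant
under it (`norm_U_mul_U_sub_le`). Weak compactness fails at `a = uₖ` for a large `k`: compressing by
initial identities gives `a qₘ a`, whose only possible weak cluster point is `a²`, while Mazur's
theorem would make `a²` a norm limit of finitely supported sequences. But `‖aₙ²‖ ≥ 1/2` for all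
large `n` (`half_le_norm_powAvg_sq`). -/

namespace BanachAlg

/-! ### Inverses of perturbations of the identity -/

/-- If `‖R‖ ≤ 1/2`, then `1 + R` has an inverse of norm at most `2`. -/
theorem exists_inv_one_add {B : Type*} [NormedRing B] [CompleteSpace B] (h1 : ‖(1 : B)‖ ≤ 1)
    {R : B} (hR : ‖R‖ ≤ 1 / 2) : ∃ V, (1 + R) * V = 1 ∧ V * (1 + R) = 1 ∧ ‖V‖ ≤ 2 := by
  have hu : IsUnit (1 - -R) := isUnit_one_sub_of_norm_lt_one (by rw [norm_neg]; linarith)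
  rw [sub_neg_eq_add] at hu
  obtain ⟨w, hw⟩ := hu
  refine ⟨↑w⁻¹, by rw [← hw, Units.mul_inv], by rw [← hw, Units.inv_mul], ?_⟩
  have h : (↑w⁻¹ : B) = 1 - R * ↑w⁻¹ := by
    have : (1 + R) * ↑w⁻¹ = 1 := by rw [← hw, Units.mul_inv]
    rw [add_mul, one_mul] at this
    exact eq_sub_of_add_eq this
  have h2 : ‖(↑w⁻¹ : B)‖ ≤ ‖(1 : B)‖ + ‖R‖ * ‖(↑w⁻¹ : B)‖ := by
    conv_lhs => rw [h]
    exact (norm_sub_le _ _).trans (add_le_add le_rfl (norm_mul_le _ _))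
  nlinarith [norm_nonneg (↑w⁻¹ : B)]

/-- If `N ^ q = 0`, then `1 + N` has an inverse of norm at most `∑_{i < q} b ^ i`, where
`‖N‖ ≤ b`. -/
theorem exists_inv_one_add_of_pow_eq_zero {B : Type*} [NormedRing B] (h1 : ‖(1 : B)‖ ≤ 1)
    {N : B} {q : ℕ} (hN : N ^ q = 0) {b : ℝ} (hb : ‖N‖ ≤ b) :
    ∃ V, (1 + N) * V = 1 ∧ V * (1 + N) = 1 ∧ ‖V‖ ≤ ∑ i ∈ Finset.range q, b ^ i := by
  have hz : (-N) ^ q = 0 := by rw [neg_pow, hN, mul_zero]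
  refine ⟨∑ i ∈ Finset.range q, (-N) ^ i, ?_, ?_, (norm_sum_le _ _).trans ?_⟩
  · have := mul_neg_geom_sum (-N) q
    rwa [hz, sub_zero, sub_neg_eq_add] at this
  · have := geom_sum_mul_neg (-N) q
    rwa [hz, sub_zero, sub_neg_eq_add] at this
  · refine Finset.sum_le_sum fun i _ => ?_
    rcases Nat.eq_zero_or_pos i with rfl | hi
    · simpa using h1
    · refine (norm_pow_le' _ hi).trans ?_
      rw [norm_neg]
      exact pow_le_pow_left₀ (norm_nonneg _) hb _

/-- Telescoping: each of the `j` steps costs one application of the hypothesis, multiplied by a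
contraction. -/
theorem norm_pow_mul_sub_le {B : Type*} [NormedRing B] {w z : B} (hw : ∀ i, ‖w ^ i‖ ≤ 1) {b : ℝ}
    (h : ‖w * z - z‖ ≤ b) (j : ℕ) : ‖w ^ j * z - z‖ ≤ j * b := by
  induction j with
  | zero => simp
  | succ j ih =>
    have e : w ^ (j + 1) * z - z = w ^ j * (w * z - z) + (w ^ j * z - z) := by
      rw [pow_succ]; noncomm_ring
    rw [e]
    refine (norm_add_le _ _).trans ?_
    have h2 : ‖w ^ j * (w * z - z)‖ ≤ 1 * b :=
      (norm_mul_le _ _).trans (mul_le_mul (hw j) h (norm_nonneg _) zero_le_one)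
    push_cast
    linarith

/-! ### Averages of powers of a contraction -/

section Average

variable {B : Type*} [NormedRing B] [NormedAlgebra ℂ B]

/-- The average of the powers of `w` with exponents in `E`. -/
noncomputable def powAvg (w : B) (E : Finset ℕ) : B := (E.card : ℂ)⁻¹ • ∑ i ∈ E, w ^ i

theorem powAvg_commute (w : B) (E F : Finset ℕ) : Commute (powAvg w E) (powAvg w F) := by
  refine Commute.smul_left (Commute.smul_right ?_ _) _
  exact Commute.sum_left _ _ _ fun i _ => Commute.sum_right _ _ _ fun j _ =>
    Commute.pow_pow_self w i j

theorem norm_powAvg_sub_le {w z : B} {E : Finset ℕ} (hE : E.Nonempty) {b : ℝ}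
    (h : ∀ i ∈ E, ‖w ^ i * z - z‖ ≤ b) : ‖powAvg w E * z - z‖ ≤ b := by
  have hc : (E.card : ℂ) ≠ 0 := by exact_mod_cast hE.card_pos.ne'
  have e : powAvg w E * z - z = (E.card : ℂ)⁻¹ • ∑ i ∈ E, (w ^ i * z - z) := by
    rw [powAvg, Finset.sum_sub_distrib, smul_sub, Finset.sum_const, ← Nat.cast_smul_eq_nsmul ℂ,
      smul_smul, inv_mul_cancel₀ hc, one_smul, smul_mul_assoc, Finset.sum_mul]
  rw [e, norm_smul, norm_inv, Complex.norm_natCast]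
  have hc' : (0 : ℝ) < E.card := by exact_mod_cast hE.card_pos
  rw [inv_mul_le_iff₀ hc']
  refine (norm_sum_le _ _).trans ((Finset.sum_le_card_nsmul _ _ b h).trans ?_)
  rw [nsmul_eq_mul]

theorem norm_powAvg_le {w : B} {E : Finset ℕ} (hE : E.Nonempty) {b : ℝ}
    (h : ∀ i ∈ E, ‖w ^ i‖ ≤ b) : ‖powAvg w E‖ ≤ b := by
  rw [powAvg, norm_smul, norm_inv, Complex.norm_natCast]
  have hc' : (0 : ℝ) < E.card := by exact_mod_cast hE.card_pos
  rw [inv_mul_le_iff₀ hc']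
  refine (norm_sum_le _ _).trans ((Finset.sum_le_card_nsmul _ _ b h).trans ?_)
  rw [nsmul_eq_mul]

/-- Multiplication by `w` shifts the interval of exponents by one, so all terms cancel but the two
end powers. -/
theorem norm_mul_powAvg_Icc_sub_le {w : B} (hw : ∀ i, ‖w ^ i‖ ≤ 1) {a b : ℕ} (hab : a ≤ b) :
    ‖w * powAvg w (Finset.Icc a b) - powAvg w (Finset.Icc a b)‖
      ≤ 2 / (Finset.Icc a b).card := by
  have e : w * ∑ i ∈ Finset.Icc a b, w ^ i - ∑ i ∈ Finset.Icc a b, w ^ i = w ^ (b + 1) - w ^ a := by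
    rw [Finset.mul_sum, ← Finset.sum_sub_distrib, ← Finset.Ico_add_one_right_eq_Icc]
    simp_rw [← pow_succ']
    exact Finset.sum_Ico_sub (fun i => w ^ i) (by omega)
  rw [powAvg, mul_smul_comm, ← smul_sub, e, norm_smul, norm_inv, Complex.norm_natCast,
    inv_mul_eq_div]
  refine div_le_div_of_nonneg_right ((norm_sub_le _ _).trans ?_) (by positivity)
  linarith [hw (b + 1), hw a]

theorem norm_powAvg_mul_powAvg_sub_le {w : B} (hw : ∀ i, ‖w ^ i‖ ≤ 1) {a b : ℕ} (hab : a ≤ b)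
    {F : Finset ℕ} (hF : F.Nonempty) {m : ℝ} (hm : ∀ i ∈ F, (i : ℝ) ≤ m) :
    ‖powAvg w F * powAvg w (Finset.Icc a b) - powAvg w (Finset.Icc a b)‖
      ≤ m * (2 / (Finset.Icc a b).card) := by
  refine norm_powAvg_sub_le hF fun i hi => ?_
  refine (norm_pow_mul_sub_le hw (norm_mul_powAvg_Icc_sub_le hw hab) i).trans ?_
  exact mul_le_mul_of_nonneg_right (hm i hi) (by positivity)

end Average

end BanachAlg

/-! ### Operator norms of matrices and of the shift -/

namespace ShiftAlg

variable {n : ℕ+}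

theorem norm_diagonal_le {v : Fin n → ℂ} {b : ℝ} (hb : 0 ≤ b) (h : ∀ i, ‖v i‖ ≤ b) :
    ‖(Matrix.diagonal v : Mat n)‖ ≤ b := by
  rw [Matrix.l2_opNorm_diagonal]
  exact (pi_norm_le_iff_of_nonneg hb).2 h

theorem norm_one_le : ‖(1 : Mat n)‖ ≤ 1 := by
  rw [← Matrix.diagonal_one]
  exact norm_diagonal_le zero_le_one fun i => by simp

theorem norm_one_prod_le : ‖(1 : Mat n × Mat n)‖ ≤ 1 :=
  norm_prod_le_iff.2 ⟨norm_one_le, norm_one_le⟩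

theorem norm_entry_le (X : Mat n) (i j : Fin n) : ‖X i j‖ ≤ ‖X‖ := by
  have h := Matrix.l2_opNorm_mulVec X (EuclideanSpace.single j (1 : ℂ))
  rw [PiLp.norm_single, norm_one, mul_one] at h
  refine le_trans ?_ h
  refine le_trans (le_of_eq ?_) (PiLp.norm_apply_le _ i)
  simp

/-- The sum of the entries is `⟨v, X v⟩` for the all-ones vector `v`, and `‖v‖² = n`. -/
theorem norm_sum_entries_le (X : Mat n) : ‖∑ i, ∑ j, X i j‖ ≤ n * ‖X‖ := by
  set v : EuclideanSpace ℂ (Fin n) := WithLp.toLp 2 (fun _ => 1) with hv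
  have hn : ‖v‖ * ‖v‖ = n := by
    rw [← sq, EuclideanSpace.norm_sq_eq]; simp [hv]
  have h := Matrix.l2_opNorm_mulVec X v
  have h2 := norm_inner_le_norm (𝕜 := ℂ) v ((EuclideanSpace.equiv (Fin n) ℂ).symm (X.mulVec v))
  have e : inner ℂ v ((EuclideanSpace.equiv (Fin n) ℂ).symm (X.mulVec v)) = ∑ i, ∑ j, X i j := by
    simp [PiLp.inner_apply, Matrix.mulVec, dotProduct, hv]
  rw [e] at h2
  refine h2.trans ?_
  calc _ ≤ ‖v‖ * (‖X‖ * ‖v‖) := mul_le_mul_of_nonneg_left h (norm_nonneg _)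
    _ = _ := by rw [← hn]; ring

theorem shift_pow_apply (m : ℕ) (i j : Fin n) :
    (shift n ^ m) i j = if (i : ℕ) + m = j then 1 else 0 := by
  induction m generalizing i with
  | zero => simp [Matrix.one_apply, Fin.ext_iff]
  | succ m ih =>
    rw [pow_succ', Matrix.mul_apply]
    simp_rw [ih]
    by_cases h : (i : ℕ) + 1 < n
    · rw [Finset.sum_eq_single ⟨(i : ℕ) + 1, h⟩]
      · simp [shift]; congr 1; simp; omega
      · intro b _ hb
        have : (i : ℕ) + 1 ≠ b := fun h' => hb (Fin.ext h'.symm)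
        simp [shift, this]
      · simp
    · rw [Finset.sum_eq_zero]
      · rw [if_neg]; omega
      · intro b _
        have : (i : ℕ) + 1 ≠ b := by omega
        simp [shift, this]

/-- `L* L` is a diagonal projection; the C⋆-identity does the rest. -/
theorem norm_shift_le : ‖shift n‖ ≤ 1 := by
  have h := Matrix.l2_opNorm_conjTranspose_mul_self (shift n)
  have e : (shift n).conjTranspose * shift n =
      Matrix.diagonal fun i : Fin n => if (i : ℕ) = 0 then (0 : ℂ) else 1 := by
    ext i j
    rw [Matrix.mul_apply, Matrix.diagonal_apply]
    simp only [Matrix.conjTranspose_apply, shift, Matrix.of_apply]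
    by_cases hi : (i : ℕ) = 0
    · rw [Finset.sum_eq_zero]
      · simp [hi]
      · intro b _
        have : (b : ℕ) + 1 ≠ i := by omega
        simp [this]
    · rw [Finset.sum_eq_single ⟨(i : ℕ) - 1, by omega⟩]
      · have : (i : ℕ) - 1 + 1 = i := by omega
        simp [this, hi, Fin.ext_iff]
      · intro b _ hb
        have : (b : ℕ) + 1 ≠ i := fun h' => hb (Fin.ext (by simp; omega))
        simp [this]
      · simp
  have h2 : ‖(shift n).conjTranspose * shift n‖ ≤ 1 := by
    rw [e]
    refine norm_diagonal_le zero_le_one fun i => ?_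
    split_ifs <;> simp
  nlinarith [norm_nonneg (shift n)]

theorem norm_pow_le_one {B : Type*} [NormedRing B] (h1 : ‖(1 : B)‖ ≤ 1) {w : B} (hw : ‖w‖ ≤ 1)
    (i : ℕ) : ‖w ^ i‖ ≤ 1 := by
  rcases Nat.eq_zero_or_pos i with rfl | hi
  · simpa using h1
  · exact (norm_pow_le' w hi).trans (pow_le_one₀ (norm_nonneg _) hw)

/-! ### Band matrices -/

/-- The entries `X i j` with `j < i + m` vanish. -/
def Band (m : ℕ) (X : Mat n) : Prop := ∀ i j : Fin n, (j : ℕ) < i + m → X i j = 0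

theorem Band.mul {m m' : ℕ} {X Y : Mat n} (hX : Band m X) (hY : Band m' Y) :
    Band (m + m') (X * Y) := fun i j hij => by
  rw [Matrix.mul_apply]
  refine Finset.sum_eq_zero fun l _ => ?_
  by_cases h : (l : ℕ) < i + m
  · rw [hX i l h, zero_mul]
  · rw [hY l j (by omega), mul_zero]

theorem Band.mono {m m' : ℕ} (h : m' ≤ m) {X : Mat n} (hX : Band m X) : Band m' X :=
  fun i j hij => hX i j (by omega)

theorem band_one : Band 0 (1 : Mat n) := fun i j hij =>
  Matrix.one_apply_ne (by rintro rfl; omega)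

theorem Band.pow {m : ℕ} {X : Mat n} (hX : Band m X) (q : ℕ) : Band (m * q) (X ^ q) := by
  induction q with
  | zero => simpa using band_one
  | succ q ih => rw [pow_succ, mul_add, mul_one]; exact ih.mul hX

theorem Band.eq_zero {m : ℕ} {X : Mat n} (hX : Band m X) (h : (n : ℕ) ≤ m) : X = 0 := by
  ext i j
  exact hX i j (by omega)

theorem Band.add {m : ℕ} {X Y : Mat n} (hX : Band m X) (hY : Band m Y) : Band m (X + Y) :=
  fun i j h => by rw [Matrix.add_apply, hX i j h, hY i j h, add_zero]

theorem Band.sub {m : ℕ} {X Y : Mat n} (hX : Band m X) (hY : Band m Y) : Band m (X - Y) :=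
  fun i j h => by rw [Matrix.sub_apply, hX i j h, hY i j h, sub_zero]

theorem Band.inv {X V : Mat n} (hX : Band 0 X) (h : X * V = 1) : Band 0 V := by
  have : Invertible X := ⟨V, mul_eq_one_comm.1 h, h⟩
  have e : X⁻¹ = V := Matrix.inv_eq_right_inv h
  have ht : X.BlockTriangular id := fun i j hij => hX i j (by simpa using hij)
  have := Matrix.blockTriangular_inv_of_blockTriangular ht
  rw [e] at this
  exact fun i j hij => this (by simpa using hij)

theorem band_powAvg_shift {m : ℕ} {E : Finset ℕ} (h : ∀ i ∈ E, m ≤ i) :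
    Band m (BanachAlg.powAvg (shift n) E) := fun i j hij => by
  rw [BanachAlg.powAvg, Matrix.smul_apply, Matrix.sum_apply, Finset.sum_eq_zero, smul_zero]
  intro l hl
  rw [shift_pow_apply, if_neg]
  have := h l hl
  omega

/-- The upper triangular part of a matrix. -/
def upperPart (X : Mat n) : Mat n := Matrix.of fun i j => if (i : ℕ) ≤ j then X i j else 0

theorem band_upperPart (X : Mat n) : Band 0 (upperPart X) := fun i j h => by
  rw [upperPart, Matrix.of_apply, if_neg]; omega

/-- The strictly lower part is a sum of subdiagonals, each a diagonal matrix times a power of the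
adjoint shift. The subdiagonal at depth `m + 1` therefore has norm at most `P r ^ (m + 1)`, and the
geometric series has ratio at most `1/2`. No factor depending on `n` appears. -/
theorem norm_sub_upperPart_le {X : Mat n} {P r : ℝ} (hP : 0 ≤ P) (hr0 : 0 ≤ r) (hr : r ≤ 1 / 2)
    (h : ∀ i j : Fin n, (j : ℕ) < i → ‖X i j‖ ≤ P * r ^ ((i : ℕ) - j)) :
    ‖X - upperPart X‖ ≤ 2 * P * r := by
  let v : ℕ → Fin n → ℂ := fun m i =>
    if hm : m + 1 ≤ (i : ℕ) then X i ⟨(i : ℕ) - (m + 1), by omega⟩ else 0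
  have e : X - upperPart X = ∑ m ∈ Finset.range n,
      Matrix.diagonal (v m) * ((shift n).conjTranspose) ^ (m + 1) := by
    ext i j
    rw [Matrix.sum_apply]
    simp_rw [Matrix.diagonal_mul, ← Matrix.conjTranspose_pow, Matrix.conjTranspose_apply,
      shift_pow_apply]
    by_cases hij : (i : ℕ) ≤ j
    · rw [Finset.sum_eq_zero]
      · rw [Matrix.sub_apply, upperPart, Matrix.of_apply, if_pos hij, sub_self]
      · intro m _
        rw [if_neg (by omega)]; simp
    · rw [Finset.sum_eq_single ((i : ℕ) - j - 1)]
      · have h1 : (j : ℕ) + ((i : ℕ) - j - 1 + 1) = i := by omega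
        have h2 : (i : ℕ) - j - 1 + 1 ≤ (i : ℕ) := by omega
        have h3 : (⟨(i : ℕ) - ((i : ℕ) - j - 1 + 1), by omega⟩ : Fin n) = j :=
          Fin.ext (by simp; omega)
        simp only [v, if_pos h1, dif_pos h2, h3, star_one, mul_one]
        rw [Matrix.sub_apply, upperPart, Matrix.of_apply, if_neg hij, sub_zero]
      · intro m _ hm
        rw [if_neg (by omega)]; simp
      · intro hm
        exact absurd (Finset.mem_range.2 (by omega)) hm
  have hterm : ∀ m ∈ Finset.range (n : ℕ),
      ‖Matrix.diagonal (v m) * ((shift n).conjTranspose) ^ (m + 1)‖ ≤ P * r * r ^ m := by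
    intro m _
    have h1 : ‖(Matrix.diagonal (v m) : Mat n)‖ ≤ P * r * r ^ m := by
      refine norm_diagonal_le (by positivity) fun i => ?_
      simp only [v]
      split_ifs with hm
      · refine (h i ⟨(i : ℕ) - (m + 1), by omega⟩ (by simp only; omega)).trans (le_of_eq ?_)
        have : (i : ℕ) - ((i : ℕ) - (m + 1)) = m + 1 := by omega
        simp only [this]
        ring
      · simp only [norm_zero]; positivity
    have h2 : ‖((shift n).conjTranspose) ^ (m + 1)‖ ≤ 1 :=
      norm_pow_le_one norm_one_le (by rw [Matrix.l2_opNorm_conjTranspose]; exact norm_shift_le) _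
    refine (norm_mul_le _ _).trans ?_
    calc _ ≤ (P * r * r ^ m) * 1 := mul_le_mul h1 h2 (norm_nonneg _) (by positivity)
      _ = _ := mul_one _
  rw [e]
  refine (norm_sum_le _ _).trans ((Finset.sum_le_sum hterm).trans ?_)
  rw [← Finset.mul_sum]
  have hg : ∑ m ∈ Finset.range (n : ℕ), r ^ m ≤ 2 := by
    refine (Summable.sum_le_tsum _ (fun i _ => by positivity)
      (summable_geometric_of_lt_one hr0 (by linarith))).trans ?_
    rw [tsum_geometric_of_lt_one hr0 (by linarith)]
    rw [inv_le_comm₀ (by linarith) (by norm_num)]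
    linarith
  calc P * r * _ ≤ P * r * 2 := mul_le_mul_of_nonneg_left hg (by positivity)
    _ = _ := by ring

/-- Invertibility of `1 + X`, with a bound independent of the size of the matrix, for a matrix `X`
that is nearly upper triangular and nearly absorbs a contraction of large bandwidth. -/
theorem exists_inv_one_add_of_band {X u : Mat n} {P r : ℝ} {m q : ℕ} (hP : 0 ≤ P) (hr0 : 0 ≤ r)
    (hr : r ≤ 1 / 2) (hX : ‖X‖ ≤ P)
    (hlow : ∀ i j : Fin n, (j : ℕ) < i → ‖X i j‖ ≤ P * r ^ ((i : ℕ) - j))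
    (hu : Band m u) (hu1 : ‖u‖ ≤ 1) (hmq : (n : ℕ) ≤ m * q) (hXu : ‖u * X - X‖ ≤ 1 / 4)
    (hr1 : 16 * P * r ≤ 1)
    (hr2 : 8 * (∑ i ∈ Finset.range q, (2 * (P + 1)) ^ i) * P * r ≤ 1) :
    ∃ V, (1 + X) * V = 1 ∧ V * (1 + X) = 1 ∧
      ‖V‖ ≤ 4 * ∑ i ∈ Finset.range q, (2 * (P + 1)) ^ i := by
  set C := ∑ i ∈ Finset.range q, (2 * (P + 1)) ^ i with hC
  have hC0 : 0 ≤ C := Finset.sum_nonneg fun i _ => by positivity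
  set T := upperPart X with hT
  set S := X - T with hS
  have hSn : ‖S‖ ≤ 2 * P * r := norm_sub_upperPart_le hP hr0 hr hlow
  have hTb : Band 0 T := band_upperPart X
  have hTn : ‖T‖ ≤ P + 1 := by
    have : T = X - S := by rw [hS]; abel
    rw [this]
    refine (norm_sub_le _ _).trans ?_
    linarith
  have hKb : Band m (u * T) := hu.mul hTb
  have hKn : ‖u * T‖ ≤ P + 1 := (norm_mul_le _ _).trans (by nlinarith [norm_nonneg T])
  -- `1 + T` will be factored as `(1 + R)(1 + V u T)` with `V = (1 + R)⁻¹`: a small perturbation of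
  -- `1` times a unipotent matrix.
  set R := T - u * T with hR
  have hRn : ‖R‖ ≤ 1 / 2 := by
    -- The three terms contribute `1/4 + 1/8 + 1/8`, since `hr1` gives `‖S‖ ≤ 2 P r ≤ 1/8`.
    have e : R = -(u * X - X) - S + u * S := by rw [hR, hS]; noncomm_ring
    have h1 : ‖u * S‖ ≤ ‖S‖ := (norm_mul_le _ _).trans (by nlinarith [norm_nonneg S])
    rw [e]
    refine (norm_add_le _ _).trans ?_
    have := norm_sub_le (-(u * X - X)) S
    rw [norm_neg] at this
    linarith
  obtain ⟨V, hV1, hV2, hVn⟩ := BanachAlg.exists_inv_one_add norm_one_le hRn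
  have hVb : Band 0 V :=
    (band_one.add (hTb.sub (hKb.mono (Nat.zero_le _)))).inv hV1
  have hNn : ‖V * (u * T)‖ ≤ 2 * (P + 1) :=
    (norm_mul_le _ _).trans (mul_le_mul hVn hKn (norm_nonneg _) zero_le_two)
  -- `V` is upper triangular, so `V u T` keeps the bandwidth `m` of `u`; its `q`-th power has
  -- bandwidth `m q ≥ n`.
  have hN0 : (V * (u * T)) ^ q = 0 := by
    refine Band.eq_zero ((hVb.mul hKb).pow q) ?_
    rwa [zero_add]
  obtain ⟨W, hW1, hW2, hWn⟩ :=
    BanachAlg.exists_inv_one_add_of_pow_eq_zero norm_one_le hN0 hNn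
  have hfac : (1 + R) * (1 + V * (u * T)) = 1 + T := by
    rw [mul_add, ← mul_assoc (1 + R), hV1, hR]; noncomm_ring
  have hi1 : (1 + T) * (W * V) = 1 := by
    rw [← hfac]
    calc _ = (1 + R) * ((1 + V * (u * T)) * W) * V := by simp only [mul_assoc]
      _ = 1 := by rw [hW1, mul_one, hV1]
  have hi2 : (W * V) * (1 + T) = 1 := by
    rw [← hfac]
    calc _ = W * (V * (1 + R)) * (1 + V * (u * T)) := by simp only [mul_assoc]
      _ = 1 := by rw [hV2, mul_one, hW2]
  have hin : ‖W * V‖ ≤ C * 2 := (norm_mul_le _ _).trans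
    (mul_le_mul hWn hVn (norm_nonneg _) hC0)
  -- The lower part is now restored as a perturbation: `2 C · 2 P r ≤ 1/2` by `hr2`.
  have hQ : ‖W * V * S‖ ≤ 1 / 2 := by
    refine (norm_mul_le _ _).trans ((mul_le_mul hin hSn (norm_nonneg _) (by positivity)).trans ?_)
    nlinarith
  obtain ⟨Z, hZ1, hZ2, hZn⟩ := BanachAlg.exists_inv_one_add norm_one_le hQ
  have hfac2 : (1 + T) * (1 + W * V * S) = 1 + X := by
    rw [mul_add, ← mul_assoc (1 + T), hi1, hS]; noncomm_ring
  refine ⟨Z * (W * V), ?_, ?_, ?_⟩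
  · rw [← hfac2]
    calc _ = (1 + T) * ((1 + W * V * S) * Z) * (W * V) := by simp only [mul_assoc]
      _ = 1 := by rw [hZ1, mul_one, hi1]
  · rw [← hfac2]
    calc _ = Z * ((W * V) * (1 + T)) * (1 + W * V * S) := by simp only [mul_assoc]
      _ = 1 := by rw [hi2, mul_one, hZ2]
  · refine (norm_mul_le _ _).trans
      ((mul_le_mul hZn hin (norm_nonneg _) zero_le_two).trans (le_of_eq (by ring)))

end ShiftAlg

namespace ShiftAlg

variable {c : ℕ+ → ℝ} {n : ℕ+}

/-! ### Conjugation by `d` -/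

theorem inv_d (h : 0 < c n) :
    (d c n)⁻¹ = Matrix.diagonal fun i : Fin n => ((c n : ℂ) ^ ((i : ℕ) + 1))⁻¹ := by
  refine Matrix.inv_eq_right_inv ?_
  have hc : (c n : ℂ) ≠ 0 := by exact_mod_cast h.ne'
  rw [d, Matrix.diagonal_mul_diagonal, ← Matrix.diagonal_one]
  congr 1
  funext i
  exact mul_inv_cancel₀ (pow_ne_zero _ hc)

theorem d_conj_apply (h : 0 < c n) (X : Mat n) (i j : Fin n) :
    (d c n * X * (d c n)⁻¹) i j =
      (c n : ℂ) ^ ((i : ℕ) + 1) * X i j * ((c n : ℂ) ^ ((j : ℕ) + 1))⁻¹ := by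
  rw [inv_d h, Matrix.mul_diagonal, d, Matrix.diagonal_mul]

theorem d_conj_one (h : 0 < c n) : d c n * 1 * (d c n)⁻¹ = 1 := by
  have hc : (c n : ℂ) ≠ 0 := by exact_mod_cast h.ne'
  rw [inv_d h, mul_one, d, Matrix.diagonal_mul_diagonal, ← Matrix.diagonal_one]
  congr 1
  funext i
  exact mul_inv_cancel₀ (pow_ne_zero _ hc)

theorem d_conj_add (X Y : Mat n) : d c n * (X + Y) * (d c n)⁻¹ =
    d c n * X * (d c n)⁻¹ + d c n * Y * (d c n)⁻¹ := by
  rw [mul_add, add_mul]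

theorem d_conj_shift (h : 0 < c n) :
    d c n * shift n * (d c n)⁻¹ = (c n : ℂ)⁻¹ • shift n := by
  have hc : (c n : ℂ) ≠ 0 := by exact_mod_cast h.ne'
  ext i j
  rw [d_conj_apply h, Matrix.smul_apply, shift, Matrix.of_apply, smul_eq_mul]
  split_ifs with hij
  · rw [← hij, pow_succ (c n : ℂ) ((i : ℕ) + 1)]
    field_simp
  · simp

theorem d_conj_pow (h : 0 < c n) (X : Mat n) (i : ℕ) :
    d c n * X ^ i * (d c n)⁻¹ = (d c n * X * (d c n)⁻¹) ^ i := by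
  induction i with
  | zero => simpa using d_conj_one h
  | succ i ih => rw [pow_succ, d_conj_mul, ih, pow_succ]

/-- Conjugation multiplies the entry `(i, j)` by `cₙ ^ (i - j)`, so a bound on `Y` makes the entries
of `X` below the diagonal decay geometrically. -/
theorem norm_lower_entry_le (h : 0 < c n) {X Y : Mat n} (hY : Y = d c n * X * (d c n)⁻¹)
    (i j : Fin n) (hij : (j : ℕ) < i) : ‖X i j‖ ≤ ‖Y‖ * ((c n)⁻¹) ^ ((i : ℕ) - j) := by
  have h1 := norm_entry_le Y i j
  have hcn : ‖(c n : ℂ)‖ = c n := by rw [Complex.norm_real, Real.norm_of_nonneg h.le]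
  have e : ‖Y i j‖ = ‖X i j‖ * (c n) ^ ((i : ℕ) - j) := by
    rw [hY, d_conj_apply h, norm_mul, norm_mul, norm_inv, norm_pow, norm_pow, hcn]
    have : (i : ℕ) + 1 = (j + 1) + ((i : ℕ) - j) := by omega
    rw [this, pow_add]
    field_simp
  rw [e] at h1
  rw [inv_pow, ← div_eq_mul_inv, le_div_iff₀ (pow_pos h _)]
  exact h1

/-! ### The averages -/

/-- The pair `(L, d L d⁻¹)`. -/
noncomputable def shiftPair (c : ℕ+ → ℝ) (n : ℕ+) : Mat n × Mat n :=
  (shift n, (c n : ℂ)⁻¹ • shift n)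

theorem U_of_le (h : 0 < c n) {k : ℕ+} (hk : k ≤ n) :
    U c k n = BanachAlg.powAvg (shiftPair c n) (E n k) := by
  rw [U, u, if_pos hk]
  ext1
  · simp only [BanachAlg.powAvg, Prod.smul_fst, Prod.fst_sum, Prod.pow_fst, shiftPair]
  · simp only [BanachAlg.powAvg, Prod.smul_snd, Prod.snd_sum, Prod.pow_snd, shiftPair,
      ← d_conj_shift h, ← d_conj_pow h]
    rw [mul_smul_comm, smul_mul_assoc, Finset.mul_sum, Finset.sum_mul]

theorem U_of_lt (h : 0 < c n) {k : ℕ+} (hk : n < k) : U c k n = 1 := by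
  rw [U, u, if_neg (not_le.2 hk), d_conj_one h]
  rfl

theorem norm_smul_shift_le {r : ℝ} (hr : 0 ≤ r) : ‖(r : ℂ) • shift n‖ ≤ r := by
  rw [norm_smul, Complex.norm_real, Real.norm_of_nonneg hr]
  exact mul_le_of_le_one_right hr norm_shift_le

theorem norm_shiftPair_snd_le (h : 0 < c n) : ‖(shiftPair c n).2‖ ≤ (c n)⁻¹ := by
  rw [shiftPair, ← Complex.ofReal_inv]
  exact norm_smul_shift_le (inv_nonneg.2 h.le)

theorem norm_shiftPair_le (h : 1 ≤ c n) : ‖shiftPair c n‖ ≤ 1 := by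
  have h1 : ‖(shiftPair c n).1‖ ≤ 1 := by rw [shiftPair]; exact norm_shift_le
  have h2 : ‖(shiftPair c n).2‖ ≤ 1 :=
    (norm_shiftPair_snd_le (zero_lt_one.trans_le h)).trans (inv_le_one_of_one_le₀ h)
  exact norm_prod_le_iff.2 ⟨h1, h2⟩

theorem norm_shiftPair_pow_le (h : 1 ≤ c n) (i : ℕ) : ‖shiftPair c n ^ i‖ ≤ 1 :=
  norm_pow_le_one (B := Mat n × Mat n) norm_one_prod_le (norm_shiftPair_le h) i

theorem one_le_div_of_le {k : ℕ+} (hk : k ≤ n) : (1 : ℚ) ≤ ((n : ℕ) : ℚ) / ((k : ℕ) : ℚ) := by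
  rw [one_le_div (by exact_mod_cast k.pos)]
  exact_mod_cast hk

theorem E_ends_le {k : ℕ+} (hk : k ≤ n) :
    ⌈((n : ℕ) : ℚ) / ((k : ℕ) : ℚ)⌉₊ ≤ ⌊2 * ((n : ℕ) : ℚ) / ((k : ℕ) : ℚ)⌋₊ := by
  have hx := one_le_div_of_le hk
  refine Nat.le_floor ?_
  have := Nat.ceil_lt_add_one (zero_le_one.trans hx)
  rw [mul_div_assoc]
  linarith

theorem E_nonempty {k : ℕ+} (hk : k ≤ n) : (E n k).Nonempty :=
  Finset.nonempty_Icc.2 (E_ends_le hk)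

/-- Rounding the endpoints leaves at least `n/k - 1` integers, and there is always at least one; the
two bounds are added. -/
theorem le_two_mul_card_E {k : ℕ+} (hk : k ≤ n) : (n : ℝ) ≤ 2 * k * (E n k).card := by
  have hx := one_le_div_of_le hk
  have h1 : (1 : ℚ) ≤ (E n k).card := by exact_mod_cast (E_nonempty hk).card_pos
  have h2 : ((n : ℕ) : ℚ) / ((k : ℕ) : ℚ) - 1 ≤ (E n k).card := by
    have ha := Nat.ceil_lt_add_one (zero_le_one.trans hx)
    have hb := Nat.lt_floor_add_one (2 * ((n : ℕ) : ℚ) / ((k : ℕ) : ℚ))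
    rw [E, Nat.card_Icc, Nat.cast_sub ((E_ends_le hk).trans (Nat.le_succ _))]
    push_cast
    rw [mul_div_assoc] at hb ⊢
    linarith
  have h3 : ((n : ℕ) : ℚ) / ((k : ℕ) : ℚ) ≤ 2 * (E n k).card := by linarith
  have hk0 : (0 : ℚ) < ((k : ℕ) : ℚ) := by exact_mod_cast k.pos
  rw [div_le_iff₀ hk0] at h3
  have h4 : ((n : ℕ) : ℚ) ≤ 2 * (k : ℕ) * (E n k).card := by linarith
  exact_mod_cast h4

theorem le_mul_of_mem_E {k : ℕ+} {i : ℕ} (hi : i ∈ E n k) : (n : ℕ) ≤ i * k := by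
  have h := (Nat.ceil_le.1 (Finset.mem_Icc.1 hi).1)
  rw [div_le_iff₀ (by exact_mod_cast k.pos)] at h
  exact_mod_cast h

theorem mul_le_of_mem_E {k : ℕ+} {i : ℕ} (hi : i ∈ E n k) : i * k ≤ 2 * (n : ℕ) := by
  have h := (Nat.le_floor_iff (by positivity)).1 (Finset.mem_Icc.1 hi).2
  rw [le_div_iff₀ (by exact_mod_cast k.pos)] at h
  exact_mod_cast h

theorem one_le_of_mem_E {k : ℕ+} {i : ℕ} (hi : i ∈ E n k) : 1 ≤ i := by
  have := le_mul_of_mem_E hi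
  have := n.pos
  rcases Nat.eq_zero_or_pos i with rfl | h
  · omega
  · exact h

theorem norm_U_le_one (h : 1 ≤ c n) (k : ℕ+) : ‖U c k n‖ ≤ 1 := by
  have h0 : 0 < c n := zero_lt_one.trans_le h
  rcases le_or_gt k n with hk | hk
  · rw [U_of_le h0 hk]
    exact BanachAlg.norm_powAvg_le (E_nonempty hk) fun i _ => norm_shiftPair_pow_le h i
  · rw [U_of_lt h0 hk]
    exact norm_one_prod_le

/-- Every exponent in the average is at least `1`, so each power contains a factor `cₙ⁻¹ Lₙ` of norm
at most `1/2`. -/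
theorem norm_U_snd_le (h : 2 ≤ c n) {k : ℕ+} (hk : k ≤ n) : ‖(U c k n).2‖ ≤ 1 / 2 := by
  have h0 : 0 < c n := by linarith
  have e : (U c k n).2 = BanachAlg.powAvg (shiftPair c n).2 (E n k) := by
    rw [U_of_le h0 hk]
    simp only [BanachAlg.powAvg, Prod.smul_snd, Prod.snd_sum, Prod.pow_snd]
  rw [e]
  refine BanachAlg.norm_powAvg_le (E_nonempty hk) fun i hi => ?_
  have h1 : ‖(shiftPair c n).2‖ ≤ 1 / 2 := by
    refine (norm_shiftPair_snd_le h0).trans ?_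
    rw [one_div]
    exact inv_anti₀ two_pos h
  refine (norm_pow_le' _ (one_le_of_mem_E hi)).trans ?_
  exact (pow_le_of_le_one (norm_nonneg _) (h1.trans (by norm_num))
    (Nat.one_le_iff_ne_zero.1 (one_le_of_mem_E hi))).trans h1

theorem U_commute (h : 0 < c n) (k m : ℕ+) : Commute (U c k n) (U c m n) := by
  rcases le_or_gt k n with hk | hk
  · rcases le_or_gt m n with hm | hm
    · rw [U_of_le h hk, U_of_le h hm]
      exact BanachAlg.powAvg_commute _ _ _
    · rw [U_of_lt h hm]; exact Commute.one_right _
  · rw [U_of_lt h hk]; exact Commute.one_left _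

/-- The exponents in `U c m n` are at most `2n/m`, while the interval averaged in `U c k n` has at
least `n/(2k)` points: `(2n/m) · 2 · (2k/n) = 8k/m`. -/
theorem norm_U_mul_U_sub_le (h : 1 ≤ c n) {k m : ℕ+} (hk : k ≤ n) (hm : m ≤ n) :
    ‖U c m n * U c k n - U c k n‖ ≤ 8 * k / m := by
  have h0 : 0 < c n := zero_lt_one.trans_le h
  rw [U_of_le h0 hk, U_of_le h0 hm]
  have hm0 : (0 : ℝ) < m := by exact_mod_cast m.pos
  have hn0 : (0 : ℝ) < n := by exact_mod_cast n.pos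
  have hcard := le_two_mul_card_E hk
  have hc0 : (0 : ℝ) < (E n k).card := by exact_mod_cast (E_nonempty hk).card_pos
  have hF : ∀ i ∈ E n m, (i : ℝ) ≤ 2 * n / m := fun i hi => by
    rw [le_div_iff₀ hm0]
    exact_mod_cast mul_le_of_mem_E hi
  refine (BanachAlg.norm_powAvg_mul_powAvg_sub_le (norm_shiftPair_pow_le h) (E_ends_le hk)
    (E_nonempty hm) hF).trans ?_
  change 2 * (n : ℝ) / m * (2 / (E n k).card) ≤ _
  rw [div_mul_div_comm, div_le_div_iff₀ (by positivity) hm0]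
  nlinarith

/-! ### Membership in the algebra -/

theorem mem_A_iff {a : M} : a ∈ A c ↔ a ∈ N c ∧ ∀ ε : ℝ, 0 < ε → ∃ k₀ : ℕ+, ∀ k ≥ k₀, ∀ n,
    ‖a n * U c k n - a n‖ ≤ ε ∧ ‖U c k n * a n - a n‖ ≤ ε := by
  refine and_congr_right fun _ => ?_
  rw [ENNReal.tendsto_nhds_zero]
  constructor
  · intro h ε hε
    obtain ⟨k₀, hk₀⟩ := eventually_atTop.1 (h (ENNReal.ofReal ε) (ENNReal.ofReal_pos.2 hε))
    refine ⟨k₀, fun k hk n => ?_⟩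
    have h1 := hk₀ k hk
    have e1 := (enorm_le_p (fun n => a n * U c k n - a n) n).trans (le_self_add.trans h1)
    have e2 := (enorm_le_p (fun n => U c k n * a n - a n) n).trans (le_add_self.trans h1)
    rw [← ofReal_norm, ENNReal.ofReal_le_ofReal_iff hε.le] at e1 e2
    exact ⟨e1, e2⟩
  · intro h ε hε
    obtain ⟨r, hr0, hr⟩ := ENNReal.lt_iff_exists_real_btwn.1 hε
    have hr0' : 0 < r := ENNReal.ofReal_pos.1 hr.1
    obtain ⟨k₀, hk₀⟩ := h (r / 2) (half_pos hr0')
    refine eventually_atTop.2 ⟨k₀, fun k hk => ?_⟩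
    refine le_trans ?_ hr.2.le
    have e : ENNReal.ofReal r = ENNReal.ofReal (r / 2) + ENNReal.ofReal (r / 2) := by
      rw [← ENNReal.ofReal_add (half_pos hr0').le (half_pos hr0').le, add_halves]
    rw [e]
    refine add_le_add (p_le_iff.2 fun n => ?_) (p_le_iff.2 fun n => ?_)
    · rw [← ofReal_norm]; exact ENNReal.ofReal_le_ofReal (hk₀ k hk n).1
    · rw [← ofReal_norm]; exact ENNReal.ofReal_le_ofReal (hk₀ k hk n).2

theorem mem_N_iff {a : M} : a ∈ N c ↔ ∀ n, (a n).2 = d c n * (a n).1 * (d c n)⁻¹ := Iff.rfl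

/-- The factors `z`, `z'` need only be bounded, not in the algebra. This is what places
quasi-inverses in `A`. -/
theorem mem_A_of_factor {a b : M} (ha : a ∈ A c) (hb : b ∈ N c)
    {z z' : ∀ n, Mat n × Mat n} {C : ℝ} (hz : ∀ n, ‖z n‖ ≤ C) (hz' : ∀ n, ‖z' n‖ ≤ C)
    (h : ∀ n, b n = z n * a n) (h' : ∀ n, b n = a n * z' n) : b ∈ A c := by
  have hC : 0 ≤ C := (norm_nonneg _).trans (hz 1)
  refine mem_A_iff.2 ⟨hb, fun ε hε => ?_⟩
  obtain ⟨k₀, hk₀⟩ := (mem_A_iff.1 ha).2 (ε / (C + 1)) (by positivity)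
  have key : C * (ε / (C + 1)) ≤ ε := by
    rw [mul_div_assoc', div_le_iff₀ (by positivity)]; nlinarith
  refine ⟨k₀, fun k hk n => ⟨?_, ?_⟩⟩
  · rw [h n, mul_assoc, ← mul_sub]
    exact (norm_mul_le _ _).trans ((mul_le_mul (hz n) (hk₀ k hk n).1 (norm_nonneg _) hC).trans key)
  · rw [h' n, ← mul_assoc, ← sub_mul]
    refine (norm_mul_le _ _).trans
      ((mul_le_mul (hk₀ k hk n).2 (hz' n) (norm_nonneg _) (by positivity)).trans ?_)
    rwa [mul_comm]

/-- For `k ≥ n₀` the defect is exactly zero: blocks with `n < k` see the identity, the others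
vanish. -/
theorem mem_A_of_support (hpos : ∀ n, 0 < c n) {b : M} (hb : b ∈ N c) {n₀ : ℕ+}
    (h : ∀ n ≥ n₀, b n = 0) : b ∈ A c := by
  refine mem_A_iff.2 ⟨hb, fun ε hε => ⟨n₀, fun k hk n => ?_⟩⟩
  rcases lt_or_ge n k with hn | hn
  · rw [U_of_lt (hpos n) hn]
    simpa using hε.le
  · rw [h n (hk.trans hn)]
    simpa using hε.le

theorem norm_apply_le (a : M) (n : ℕ+) : ‖a n‖ ≤ ‖a‖ :=
  lp.norm_apply_le_norm ENNReal.top_ne_zero a n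

theorem continuous_apply_M (n : ℕ+) : Continuous fun a : M => a n :=
  (continuous_apply n).comp lp.uniformContinuous_coe.continuous

theorem isClosed_N : IsClosed (N c : Set M) := by
  have : (N c : Set M) = ⋂ n, {a : M | (a n).2 = d c n * (a n).1 * (d c n)⁻¹} := by
    ext a; simp [mem_N_iff]
  rw [this]
  refine isClosed_iInter fun n => isClosed_eq ?_ ?_
  · exact continuous_snd.comp (continuous_apply_M n)
  · exact (continuous_const.mul (continuous_fst.comp (continuous_apply_M n))).mul continuous_const

theorem norm_U_le_one_of_ge (hpos : ∀ n, 0 < c n) {n₀ : ℕ+} (h : ∀ n ≥ n₀, 1 ≤ c n) {k : ℕ+}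
    (hk : n₀ ≤ k) (n : ℕ+) : ‖U c k n‖ ≤ 1 := by
  rcases lt_or_ge n k with hn | hn
  · rw [U_of_lt (hpos n) hn]; exact norm_one_prod_le
  · exact norm_U_le_one (h n (hk.trans hn)) k

theorem isClosed_A (hpos : ∀ n, 0 < c n) {n₀ : ℕ+} (h : ∀ n ≥ n₀, 1 ≤ c n) :
    IsClosed (A c : Set M) := by
  refine isClosed_of_closure_subset fun x hx => ?_
  refine mem_A_iff.2 ⟨isClosed_N.closure_subset_iff.2 (fun a ha => ha.1) hx, fun ε hε => ?_⟩
  obtain ⟨a, ha, hxa⟩ := Metric.mem_closure_iff.1 hx (ε / 3) (by positivity)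
  rw [dist_eq_norm] at hxa
  obtain ⟨k₀, hk₀⟩ := (mem_A_iff.1 ha).2 (ε / 3) (by positivity)
  refine ⟨max k₀ n₀, fun k hk n => ?_⟩
  have hU := norm_U_le_one_of_ge hpos h ((le_max_right _ _).trans hk) n
  have hd : ‖x n - a n‖ ≤ ε / 3 := (norm_apply_le (x - a) n).trans hxa.le
  obtain ⟨h1, h2⟩ := hk₀ k ((le_max_left _ _).trans hk) n
  constructor
  · have e : x n * U c k n - x n = (x n - a n) * U c k n + (a n * U c k n - a n) - (x n - a n) := by
      noncomm_ring
    have h3 : ‖(x n - a n) * U c k n‖ ≤ ε / 3 :=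
      (norm_mul_le _ _).trans ((mul_le_of_le_one_right (norm_nonneg _) hU).trans hd)
    rw [e]
    refine (norm_sub_le _ _).trans ?_
    have := norm_add_le ((x n - a n) * U c k n) (a n * U c k n - a n)
    linarith
  · have e : U c k n * x n - x n = U c k n * (x n - a n) + (U c k n * a n - a n) - (x n - a n) := by
      noncomm_ring
    have h3 : ‖U c k n * (x n - a n)‖ ≤ ε / 3 :=
      (norm_mul_le _ _).trans ((mul_le_of_le_one_left (norm_nonneg _) hU).trans hd)
    rw [e]
    refine (norm_sub_le _ _).trans ?_
    have := norm_add_le (U c k n * (x n - a n)) (U c k n * a n - a n)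
    linarith

/-! ### The elements of the algebra -/

/-- The sequence `(U c k n)ₙ` as an element of the algebra. -/
theorem exists_U_mem_A (hpos : ∀ n, 0 < c n) {n₀ : ℕ+} (h : ∀ n ≥ n₀, 1 ≤ c n) {k : ℕ+}
    (hk : n₀ ≤ k) : ∃ a : A c, ‖a‖ ≤ 1 ∧ ∀ n, (a : M) n = U c k n := by
  have hU := norm_U_le_one_of_ge hpos h hk
  have hmem : Memℓp (fun n => U c k n) ∞ := memℓp_infty ⟨1, by rintro _ ⟨n, rfl⟩; exact hU n⟩
  let a : M := ⟨fun n => U c k n, hmem⟩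
  have ha : ∀ n, a n = U c k n := fun n => rfl
  have haA : a ∈ A c := by
    refine mem_A_iff.2 ⟨fun n => rfl, fun ε hε => ?_⟩
    obtain ⟨m₀, hm₀⟩ := exists_nat_gt (8 * k / ε)
    refine ⟨max k ⟨m₀ + 1, m₀.succ_pos⟩, fun m hm n => ?_⟩
    have hcomm : a n * U c m n = U c m n * a n := U_commute (hpos n) k m
    rw [hcomm, and_self, ha]
    rcases lt_or_ge n m with hn | hn
    · rw [U_of_lt (hpos n) hn]; simpa using hε.le
    · have hkm : k ≤ m := (le_max_left _ _).trans hm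
      refine (norm_U_mul_U_sub_le (h n (hk.trans (hkm.trans hn))) (hkm.trans hn) hn).trans ?_
      have hmm : (m₀ : ℝ) ≤ m := by
        have : (⟨m₀ + 1, m₀.succ_pos⟩ : ℕ+) ≤ m := (le_max_right _ _).trans hm
        have : m₀ + 1 ≤ (m : ℕ) := this
        exact_mod_cast (Nat.le_succ _).trans this
      rw [div_lt_iff₀ hε] at hm₀
      rw [div_le_iff₀ (by exact_mod_cast m.pos)]
      nlinarith
  exact ⟨⟨a, haA⟩, lp.norm_le_of_forall_le zero_le_one hU, ha⟩

/-- In the second coordinate the elements of the algebra tend to zero. -/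
theorem exists_norm_snd_le {n₀ : ℕ+} (h : ∀ n ≥ n₀, 2 ≤ c n) {a : M} (ha : a ∈ A c) {ε : ℝ}
    (hε : 0 < ε) : ∃ n₁, ∀ n ≥ n₁, ‖(a n).2‖ ≤ ε := by
  obtain ⟨k₀, hk₀⟩ := (mem_A_iff.1 ha).2 (ε / 2) (half_pos hε)
  refine ⟨max k₀ n₀, fun n hn => ?_⟩
  have h1 := (norm_prod_le_iff.1 (hk₀ k₀ le_rfl n).1).2
  have h2 := norm_U_snd_le (h n ((le_max_right _ _).trans hn)) ((le_max_left _ _).trans hn)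
  rw [Prod.snd_sub, Prod.snd_mul] at h1
  -- This gives `‖y‖ ≤ ‖y‖/2 + ε/2` for `y = (a n).2`, whence `‖y‖ ≤ ε`.
  have e : (a n).2 = (a n).2 * (U c k₀ n).2 - ((a n).2 * (U c k₀ n).2 - (a n).2) := by abel
  have h3 : ‖(a n).2 * (U c k₀ n).2‖ ≤ ‖(a n).2‖ * (1 / 2) :=
    (norm_mul_le _ _).trans (mul_le_mul_of_nonneg_left h2 (norm_nonneg _))
  have h4 : ‖(a n).2‖ ≤ ‖(a n).2‖ * (1 / 2) + ε / 2 := by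
    conv_lhs => rw [e]
    exact (norm_sub_le _ _).trans (add_le_add h3 h1)
  linarith

/-- For `a` in the algebra the matrices `1 + aₙ`, with `n` large, have uniformly bounded
inverses. -/
theorem exists_inv_tail (htop : Tendsto c atTop atTop) {a : M} (ha : a ∈ A c) :
    ∃ n₁ C, ∀ n ≥ n₁, ∃ v : Mat n × Mat n, (1 + a n) * v = 1 ∧ v * (1 + a n) = 1 ∧ ‖v‖ ≤ C := by
  obtain ⟨n₀, hn₀⟩ := eventually_atTop.1 (htop.eventually_ge_atTop 2)
  obtain ⟨n₂, hn₂⟩ := exists_norm_snd_le hn₀ ha (ε := 1 / 2) (by norm_num)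
  obtain ⟨k, hk⟩ := (mem_A_iff.1 ha).2 (1 / 4) (by norm_num)
  set P := ‖a‖ with hP
  have hP0 : 0 ≤ P := norm_nonneg _
  set C := ∑ i ∈ Finset.range (k : ℕ), (2 * (P + 1)) ^ i with hC
  have hC0 : 0 ≤ C := Finset.sum_nonneg fun i _ => by positivity
  -- `k` is fixed before `n₃`, so `C` does not depend on `n`; then `1/cₙ` is made small relative to
  -- both `P` and `C P`.
  obtain ⟨n₃, hn₃⟩ := eventually_atTop.1 (htop.eventually_ge_atTop (max (16 * P) (8 * C * P)))
  refine ⟨max (max n₀ n₂) (max k n₃), max (4 * C) 2, fun n hn => ?_⟩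
  have hn0 : n₀ ≤ n := ((le_max_left _ _).trans (le_max_left _ _)).trans hn
  have hn2 : n₂ ≤ n := ((le_max_right _ _).trans (le_max_left _ _)).trans hn
  have hnk : k ≤ n := ((le_max_left _ _).trans (le_max_right _ _)).trans hn
  have hn3 : n₃ ≤ n := ((le_max_right _ _).trans (le_max_right _ _)).trans hn
  have hc2 : 2 ≤ c n := hn₀ n hn0
  have hc0 : 0 < c n := by linarith
  have han := norm_prod_le_iff.1 (norm_apply_le a n)
  have hU := norm_prod_le_iff.1 (norm_U_le_one (by linarith : 1 ≤ c n) k)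
  have hu : (U c k n).1 = BanachAlg.powAvg (shift n) (E n k) := by
    rw [U, u, if_pos hnk]; rfl
  have hband : Band ⌈((n : ℕ) : ℚ) / ((k : ℕ) : ℚ)⌉₊ (U c k n).1 := by
    rw [hu]
    exact band_powAvg_shift fun i hi => (Finset.mem_Icc.1 hi).1
  have hmq : (n : ℕ) ≤ ⌈((n : ℕ) : ℚ) / ((k : ℕ) : ℚ)⌉₊ * k :=
    le_mul_of_mem_E (Finset.left_mem_Icc.2 (E_ends_le hnk))
  have hr1 : 16 * P * (c n)⁻¹ ≤ 1 := by
    rw [← div_eq_mul_inv, div_le_one hc0]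
    exact (le_max_left _ _).trans (hn₃ n hn3)
  have hr2 : 8 * C * P * (c n)⁻¹ ≤ 1 := by
    rw [← div_eq_mul_inv, div_le_one hc0]
    exact (le_max_right _ _).trans (hn₃ n hn3)
  have hlow : ∀ i j : Fin n, (j : ℕ) < i → ‖(a n).1 i j‖ ≤ P * ((c n)⁻¹) ^ ((i : ℕ) - j) :=
    fun i j hij => (norm_lower_entry_le hc0 (ha.1 n) i j hij).trans
      (mul_le_mul_of_nonneg_right han.2 (by positivity))
  obtain ⟨V, hV1, hV2, hVn⟩ := exists_inv_one_add_of_band hP0 (inv_nonneg.2 hc0.le)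
    (by rw [one_div]; exact inv_anti₀ two_pos hc2) han.1 hlow hband hU.1 hmq
    (norm_prod_le_iff.1 (hk k le_rfl n).2).1 hr1 hr2
  obtain ⟨W, hW1, hW2, hWn⟩ := BanachAlg.exists_inv_one_add norm_one_le (hn₂ n hn2)
  exact ⟨(V, W), Prod.ext hV1 hW1, Prod.ext hV2 hW2,
    norm_prod_le_iff.2 ⟨hVn.trans (le_max_left _ _), hWn.trans (le_max_right _ _)⟩⟩

theorem isUnit_fst_of_isUnit_snd (hc : 0 < c n) {X Y : Mat n} (hY : Y = d c n * X * (d c n)⁻¹)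
    (h : IsUnit (1 + Y)) : IsUnit (1 + X) := by
  have hd : IsUnit (d c n) := by
    have := d_conj_one hc
    rw [mul_one] at this
    exact IsUnit.of_mul_eq_one _ this
  have hd' : IsUnit (d c n)⁻¹ := by
    have := d_conj_one hc
    rw [mul_one] at this
    exact IsUnit.of_mul_eq_one _ (mul_eq_one_comm.1 this)
  have e : 1 + Y = d c n * (1 + X) * (d c n)⁻¹ := by rw [d_conj_add, d_conj_one hc, hY]
  rw [e] at h
  have h2 := (hd'.mul_right_iff).1 h
  exact (hd.mul_left_iff).1 h2

/-- The quasi-inverse is `-v a` with `v = (1 + a)⁻¹` taken blockwise. The inverses are bounded on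
the tail by `exists_inv_tail`, and the remaining blocks are finite in number. -/
theorem isQuasiregular_of_isUnit (hpos : ∀ n, 0 < c n) (htop : Tendsto c atTop atTop) (a : A c)
    (h : ∀ n, IsUnit (1 + (a : M) n)) : IsQuasiregular a := by
  obtain ⟨n₁, C, hC⟩ := exists_inv_tail htop a.2
  have hv : ∀ n, ∃ v : Mat n × Mat n, (1 + (a : M) n) * v = 1 ∧ v * (1 + (a : M) n) = 1 ∧
      (n₁ ≤ n → ‖v‖ ≤ C) := fun n => by
    by_cases hn : n₁ ≤ n
    · obtain ⟨v, h1, h2, h3⟩ := hC n hn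
      exact ⟨v, h1, h2, fun _ => h3⟩
    · obtain ⟨w, hw⟩ := h n
      exact ⟨↑w⁻¹, by rw [← hw, Units.mul_inv], by rw [← hw, Units.inv_mul],
        fun h' => absurd h' hn⟩
  choose v hv1 hv2 hv3 using hv
  obtain ⟨C', hC'⟩ : ∃ C', ∀ n, ‖v n‖ ≤ C' := by
    refine ⟨C ⊔ ∑ n ∈ Finset.Iio n₁, ‖v n‖, fun n => ?_⟩
    rcases lt_or_ge n n₁ with hn | hn
    · exact (Finset.single_le_sum (f := fun n => ‖v n‖) (fun i _ => norm_nonneg _)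
        (Finset.mem_Iio.2 hn)).trans le_sup_right
    · exact (hv3 n hn).trans le_sup_left
  have hcomm : ∀ n, v n * (a : M) n = (a : M) n * v n := fun n => by
    have h1 := hv1 n
    have h2 := hv2 n
    rw [add_mul, one_mul] at h1
    rw [mul_add, mul_one] at h2
    exact add_left_cancel (h2.trans h1.symm)
  have hmem : Memℓp (fun n => -v n * (a : M) n) ∞ := by
    refine memℓp_infty ⟨C' * ‖(a : M)‖, ?_⟩
    rintro _ ⟨n, rfl⟩
    refine (norm_mul_le _ _).trans ?_
    rw [norm_neg]
    exact mul_le_mul (hC' n) (norm_apply_le _ n) (norm_nonneg _) ((norm_nonneg _).trans (hC' n))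
  let b : M := ⟨_, hmem⟩
  have hb : ∀ n, b n = -v n * (a : M) n := fun n => rfl
  have hvN : ∀ n, (v n).2 = d c n * (v n).1 * (d c n)⁻¹ := fun n => by
    have h1 : (v n).1 * (1 + ((a : M) n).1) = 1 := congrArg Prod.fst (hv2 n)
    have h2 : (1 + ((a : M) n).2) * (v n).2 = 1 := congrArg Prod.snd (hv1 n)
    -- Uniqueness of inverses: the conjugate of `(1 + xₙ)⁻¹` inverts `1 + yₙ`, so `v` respects the
    -- relation defining `N`.
    have h3 : (d c n * (v n).1 * (d c n)⁻¹) * (1 + ((a : M) n).2) = 1 := by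
      have := d_conj_one (n := n) (hpos n)
      rwa [← h1, d_conj_mul, d_conj_add, d_conj_one (hpos n), ← a.2.1 n, h1] at this
    exact (left_inv_eq_right_inv h3 h2).symm
  have hbN : b ∈ N c := fun n => by
    rw [hb, Prod.snd_mul, Prod.fst_mul, d_conj_mul, ← a.2.1 n, Prod.snd_neg, Prod.fst_neg, hvN]
    simp only [mul_neg, neg_mul]
  have hbA : b ∈ A c := by
    refine mem_A_of_factor a.2 hbN (z := fun n => -v n) (z' := fun n => -v n) (C := C')
      (fun n => by rw [norm_neg]; exact hC' n) (fun n => by rw [norm_neg]; exact hC' n) hb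
      fun n => ?_
    rw [hb, neg_mul, mul_neg, hcomm]
  refine isQuasiregular_iff.2 ⟨⟨b, hbA⟩, ?_, ?_⟩
  · refine Subtype.ext (lp.ext (funext fun n => ?_))
    change b n + (a : M) n + (a : M) n * b n = 0
    rw [hb]
    have := congrArg (· * (a : M) n) (hv1 n)
    simp only [one_mul] at this
    conv_lhs => enter [1, 2]; rw [← this]
    noncomm_ring
  · refine Subtype.ext (lp.ext (funext fun n => ?_))
    change (a : M) n + b n + b n * (a : M) n = 0
    rw [hb]
    have := congrArg (· * (a : M) n) (hv2 n)
    simp only [one_mul] at this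
    conv_lhs => enter [1, 1]; rw [← this]
    noncomm_ring

theorem isQuasiregular_of_norm_lt (hpos : ∀ n, 0 < c n) (htop : Tendsto c atTop atTop) (a : A c)
    {n₁ : ℕ+} (h : ∀ n ≥ n₁, ‖((a : M) n).2‖ < 1) (h' : ∀ n < n₁, IsUnit (1 + ((a : M) n).1)) :
    IsQuasiregular a := by
  refine isQuasiregular_of_isUnit hpos htop a fun n => ?_
  have key : IsUnit (1 + ((a : M) n).2) ∧ IsUnit (1 + ((a : M) n).1) := by
    rcases lt_or_ge n n₁ with hn | hn
    · refine ⟨?_, h' n hn⟩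
      obtain ⟨w, hw⟩ := h' n hn
      have e : 1 + ((a : M) n).2 = d c n * (1 + ((a : M) n).1) * (d c n)⁻¹ := by
        rw [d_conj_add, d_conj_one (hpos n), a.2.1 n]
      refine IsUnit.of_mul_eq_one (d c n * (↑w⁻¹ : Mat n) * (d c n)⁻¹) ?_
      rw [e, ← d_conj_mul, ← hw, Units.mul_inv, d_conj_one (hpos n)]
    · have : IsUnit (1 - -((a : M) n).2) :=
        isUnit_one_sub_of_norm_lt_one (by rw [norm_neg]; exact h n hn)
      rw [sub_neg_eq_add] at this
      exact ⟨this, isUnit_fst_of_isUnit_snd (hpos n) (a.2.1 n) this⟩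
  exact Prod.isUnit_iff.2 ⟨key.2, key.1⟩

end ShiftAlg

/-! ### Subsets of the plane accumulating only at zero -/

theorem Set.finite_or_eq_insert_zero_range {S : Set ℂ} (h0 : (0 : ℂ) ∈ S)
    (hS : ∀ δ : ℝ, 0 < δ → {z ∈ S | δ ≤ ‖z‖}.Finite) :
    S.Finite ∨ ∃ l : ℕ → ℂ, Tendsto l atTop (𝓝 0) ∧ S = insert 0 (Set.range l) := by
  by_cases hfin : S.Finite
  · exact Or.inl hfin
  right
  have hcount : S.Countable := by
    have hsub : S ⊆ {0} ∪ ⋃ m : ℕ, {z ∈ S | 1 / ((m : ℝ) + 1) ≤ ‖z‖} := fun z hz => by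
      by_cases hz0 : z = 0
      · exact Or.inl hz0
      · obtain ⟨m, hm⟩ := exists_nat_one_div_lt (norm_pos_iff.2 hz0)
        exact Or.inr (Set.mem_iUnion.2 ⟨m, hz, hm.le⟩)
    exact ((Set.countable_singleton _).union (Set.countable_iUnion fun m =>
      (hS _ (by positivity)).countable)).mono hsub
  have : Infinite S := Set.infinite_coe_iff.2 hfin
  have : Countable S := hcount.to_subtype
  obtain ⟨e⟩ : Nonempty (S ≃ ℕ) := nonempty_equiv_of_countable
  refine ⟨fun i => (e.symm i : ℂ), ?_, ?_⟩
  · rw [← Nat.cofinite_eq_atTop, Metric.tendsto_nhds]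
    intro ε hε
    rw [eventually_cofinite]
    refine ((hS ε hε).preimage ((Subtype.val_injective.comp e.symm.injective).injOn)).subset ?_
    intro i hi
    simp only [Set.mem_ofPred_eq, dist_zero_right, not_lt] at hi
    exact ⟨(e.symm i).2, hi⟩
  · ext z
    constructor
    · exact fun hz => Or.inr ⟨e ⟨z, hz⟩, by simp⟩
    · rintro (rfl | ⟨i, rfl⟩)
      · exact h0
      · exact (e.symm i).2

namespace BanachAlg

theorem isApproximatelyUnital_of_seq {B : Type*} [NonUnitalNormedRing B] [NormedSpace ℂ B]
    {v : ℕ+ → B} {k₁ : ℕ+} (hv : ∀ k ≥ k₁, ‖v k‖ ≤ 1)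
    (h : ∀ (a : B) (ε : ℝ), 0 < ε → ∃ k₀, ∀ k ≥ k₀, ‖a * v k - a‖ ≤ ε ∧ ‖v k * a - a‖ ≤ ε) :
    IsApproximatelyUnital B := by
  refine ⟨map v atTop, { tendsto_mul_left := fun a => ?_, tendsto_mul_right := fun a => ?_ }, ?_⟩
  · rw [tendsto_map'_iff, Metric.tendsto_atTop]
    intro ε hε
    obtain ⟨k₀, hk₀⟩ := h a (ε / 2) (half_pos hε)
    exact ⟨k₀, fun k hk => by
      rw [dist_eq_norm]; exact (hk₀ k hk).1.trans_lt (half_lt_self hε)⟩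
  · rw [tendsto_map'_iff, Metric.tendsto_atTop]
    intro ε hε
    obtain ⟨k₀, hk₀⟩ := h a (ε / 2) (half_pos hε)
    exact ⟨k₀, fun k hk => by
      rw [dist_eq_norm]; exact (hk₀ k hk).2.trans_lt (half_lt_self hε)⟩
  · rw [eventually_map]
    exact eventually_atTop.2 ⟨k₁, hv⟩

end BanachAlg

/-! ### Algebras represented by sequences of matrix blocks -/

namespace ShiftAlg

variable {n : ℕ+}

/-- A faithful representation of an algebra by sequences of matrices whose image contains the
finitely supported sequences. -/
structure BlockSystem (B : Type*) [NonUnitalRing B] [Module ℂ B] where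
  /-- The `n`-th coordinate. -/
  co (n : ℕ+) : B →ₗ[ℂ] Mat n
  co_mul (n : ℕ+) (a b : B) : co n (a * b) = co n a * co n b
  ext_co {a b : B} (h : ∀ n, co n a = co n b) : a = b
  /-- The element with a given `n`-th coordinate and all others zero. -/
  block (n : ℕ+) (X : Mat n) : B
  co_block_self {n : ℕ+} (X : Mat n) : co n (block n X) = X
  co_block_ne {m n : ℕ+} (h : m ≠ n) (X : Mat n) : co m (block n X) = 0

namespace BlockSystem

section Algebraic

variable {B : Type*} [NonUnitalRing B] [Module ℂ B]

/-- A block system given by functions that are not bundled as linear maps. -/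
def ofFun (f : ∀ n : ℕ+, B → Mat n) (hadd : ∀ n a b, f n (a + b) = f n a + f n b)
    (hsmul : ∀ n (r : ℂ) a, f n (r • a) = r • f n a)
    (hmul : ∀ n a b, f n (a * b) = f n a * f n b)
    (hext : ∀ a b, (∀ n, f n a = f n b) → a = b) (g : ∀ n : ℕ+, Mat n → B)
    (hself : ∀ n X, f n (g n X) = X) (hne : ∀ m n, m ≠ n → ∀ X, f m (g n X) = 0) :
    BlockSystem B where
  co n := ⟨⟨f n, hadd n⟩, hsmul n⟩
  co_mul := hmul
  ext_co h := hext _ _ h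
  block := g
  co_block_self := hself _
  co_block_ne h := hne _ _ h

variable (S : BlockSystem B)

theorem block_add (X Y : Mat n) : S.block n (X + Y) = S.block n X + S.block n Y := by
  refine S.ext_co fun m => ?_
  rw [map_add]
  by_cases h : m = n
  · subst h; simp only [S.co_block_self]
  · simp only [S.co_block_ne h, add_zero]

theorem block_zero : S.block n (0 : Mat n) = 0 := by
  have := S.block_add (0 : Mat n) 0
  rw [add_zero] at this
  exact left_eq_add.1 this

theorem block_mul (a : B) (X : Mat n) : a * S.block n X = S.block n (S.co n a * X) := by
  refine S.ext_co fun m => ?_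
  rw [S.co_mul]
  by_cases h : m = n
  · subst h; simp only [S.co_block_self]
  · simp only [S.co_block_ne h, mul_zero]

theorem mul_block (a : B) (X : Mat n) : S.block n X * a = S.block n (X * S.co n a) := by
  refine S.ext_co fun m => ?_
  rw [S.co_mul]
  by_cases h : m = n
  · subst h; simp only [S.co_block_self]
  · simp only [S.co_block_ne h, zero_mul]

theorem block_ne_zero {X : Mat n} (hX : X ≠ 0) : S.block n X ≠ 0 := fun h => hX (by
  rw [← S.co_block_self X, h, map_zero])

/-! ### Semisimplicity -/

/-- The ideal is the set of elements killing the `j`-th basis vector of block `n`. Together these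
ideals detect every entry, so their intersection is zero. -/
theorem isMaxModularLeftIdeal_col (n : ℕ+) (j : Fin n) : ∃ J : Submodule ℂ B,
    BanachAlg.IsMaxModularLeftIdeal J ∧ ∀ a ∈ J, ∀ i, S.co n a i j = 0 := by
  let J : Submodule ℂ B :=
    { carrier := {a | ∀ i, S.co n a i j = 0}
      add_mem' := fun {a b} ha hb i => by rw [map_add, Matrix.add_apply, ha i, hb i, add_zero]
      zero_mem' := fun i => by rw [map_zero, Matrix.zero_apply]
      smul_mem' := fun r a ha i => by rw [map_smul, Matrix.smul_apply, ha i, smul_zero] }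
  have hJ : ∀ {a : B}, a ∈ J ↔ ∀ i, S.co n a i j = 0 := Iff.rfl
  refine ⟨J, ⟨fun a x hx i => ?_, fun htop => ?_, fun K hK hlt => ?_, S.block n 1, fun x i => ?_⟩,
    fun a ha => ha⟩
  · rw [S.co_mul, Matrix.mul_apply]
    exact Finset.sum_eq_zero fun l _ => by rw [hJ.1 hx l, mul_zero]
  · have : S.block n 1 ∈ J := htop ▸ Submodule.mem_top
    have := hJ.1 this j
    rw [S.co_block_self, Matrix.one_apply_eq] at this
    exact one_ne_zero this
  · obtain ⟨a, haK, haJ⟩ := SetLike.exists_of_lt hlt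
    rw [hJ, not_forall] at haJ
    obtain ⟨i, hi⟩ := haJ
    refine eq_top_iff.2 fun b _ => ?_
    -- `X` is supported on column `i`, scaled so that `X` times block `n` of `a` has the same `j`-th
    -- column as block `n` of `b`.
    let X : Mat n := Matrix.of fun r s => if s = i then S.co n b r j * (S.co n a i j)⁻¹ else 0
    have h1 : S.block n X * a ∈ K := hK _ _ haK
    have h2 : b - S.block n X * a ∈ J := fun r => by
      rw [map_sub, Matrix.sub_apply, S.co_mul, S.co_block_self, Matrix.mul_apply,
        Finset.sum_eq_single i]
      · simp [X, hi]
      · intro s _ hs; simp [X, hs]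
      · simp
    have := K.add_mem (hlt.le h2) h1
    rwa [sub_add_cancel] at this
  · rw [map_sub, S.co_mul, S.co_block_self, mul_one, sub_self, Matrix.zero_apply]

theorem isSemisimple (S : BlockSystem B) : BanachAlg.IsSemisimple B := fun x hx => by
  refine S.ext_co fun n => ?_
  rw [map_zero]
  ext i j
  obtain ⟨J, hJ, hJ'⟩ := S.isMaxModularLeftIdeal_col n j
  exact hJ' x (hx J hJ) i

/-! ### Annihilators -/

/-- With `x` the matrix unit at `(j, i)`, the entry `(i, j)` of `a x a` is the square of that of
`a`. -/
theorem eq_zero_of_mul_mul_eq_zero (S : BlockSystem B) (a : B) (h : ∀ x : B, a * x * a = 0) :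
    a = 0 := by
  refine S.ext_co fun n => ?_
  rw [map_zero]
  ext i j
  have h1 := congrArg (S.co n) (h (S.block n (Matrix.single j i 1)))
  rw [S.co_mul, S.co_mul, S.co_block_self, map_zero] at h1
  have h2 := congrFun (congrFun h1 i) j
  rw [Matrix.mul_apply, Finset.sum_eq_single i] at h2
  · simpa using h2
  · intro l _ hl
    simp [hl]
  · simp

/-- The tails of every element of the algebra are eventually negatives of quasiregular elements. -/
def QuasiregularTails : Prop := ∀ e : B, ∃ n₁ : ℕ+, ∀ t : B, (∀ m < n₁, S.co m t = 0) →
  (∀ m ≥ n₁, S.co m t = S.co m e) → IsQuasiregular (-t)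

variable {S}

theorem QuasiregularTails.exists_sum_block_add (hS : S.QuasiregularTails) (e : B) :
    ∃ (n₁ : ℕ+) (t : B), e = t + ∑ n ∈ Finset.Iio n₁, S.block n (S.co n e) ∧
      IsQuasiregular (-t) := by
  obtain ⟨n₁, hn₁⟩ := hS e
  refine ⟨n₁, e - ∑ n ∈ Finset.Iio n₁, S.block n (S.co n e), (sub_add_cancel _ _).symm,
    hn₁ _ (fun m hm => ?_) fun m hm => ?_⟩
  · rw [map_sub, map_sum, Finset.sum_eq_single m, S.co_block_self, sub_self]
    · intro n _ hn; exact S.co_block_ne hn.symm _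
    · intro h; exact absurd (Finset.mem_Iio.2 hm) h
  · rw [map_sub, map_sum, Finset.sum_eq_zero, sub_zero]
    intro n hn
    exact S.co_block_ne ((Finset.mem_Iio.1 hn).trans_le hm).ne' _

/-- If all blocks lay in `J`, then `e` would be congruent to its tail `t`; the quasi-inverse `y` of
`-t` puts `t`, hence `e`, into `J`, and then `J` is everything. -/
theorem exists_block_notMem_of_isLeftIdeal (hS : S.QuasiregularTails) {J : Submodule ℂ B}
    (hJ : BanachAlg.IsLeftIdeal J) (hne : J ≠ ⊤) {e : B} (he : ∀ x, x - x * e ∈ J) :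
    ∃ n X, S.block n X ∉ J := by
  by_contra! hall
  obtain ⟨n₁, t, het, hq⟩ := hS.exists_sum_block_add e
  set s := ∑ n ∈ Finset.Iio n₁, S.block n (S.co n e) with hs
  have hsJ : s ∈ J := J.sum_mem fun n _ => hall n _
  obtain ⟨y, -, hy⟩ := isQuasiregular_iff.1 hq
  have ht : t = (y - y * e) + y * s := by
    have h1 : y * e = y * t + y * s := by rw [← mul_add, ← het]
    rw [mul_neg] at hy
    rw [h1, ← sub_eq_zero, ← neg_eq_zero, ← hy]
    abel
  have htJ : t ∈ J := by
    rw [ht]; exact J.add_mem (he y) (hJ y _ hsJ)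
  have heJ : e ∈ J := by rw [het]; exact J.add_mem htJ hsJ
  refine hne (eq_top_iff.2 fun x _ => ?_)
  have := J.add_mem (he x) (hJ x _ heJ)
  rwa [sub_add_cancel] at this

theorem exists_block_notMem_of_isRightIdeal (hS : S.QuasiregularTails) {J : Submodule ℂ B}
    (hJ : BanachAlg.IsRightIdeal J) (hne : J ≠ ⊤) {e : B} (he : ∀ x, x - e * x ∈ J) :
    ∃ n X, S.block n X ∉ J := by
  by_contra! hall
  obtain ⟨n₁, t, het, hq⟩ := hS.exists_sum_block_add e
  set s := ∑ n ∈ Finset.Iio n₁, S.block n (S.co n e) with hs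
  have hsJ : s ∈ J := J.sum_mem fun n _ => hall n _
  obtain ⟨y, hy, -⟩ := isQuasiregular_iff.1 hq
  have ht : t = (y - e * y) + s * y := by
    have h1 : e * y = t * y + s * y := by rw [← add_mul, ← het]
    rw [neg_mul] at hy
    rw [h1, ← sub_eq_zero, ← neg_eq_zero, ← hy]
    abel
  have htJ : t ∈ J := by
    rw [ht]; exact J.add_mem (he y) (hJ y _ hsJ)
  have heJ : e ∈ J := by rw [het]; exact J.add_mem htJ hsJ
  refine hne (eq_top_iff.2 fun x _ => ?_)
  have := J.add_mem (he x) (hJ x _ heJ)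
  rwa [sub_add_cancel] at this

/-- By semisimplicity of the matrix ring the left ideal is generated by an idempotent `e`; `1 - e`
annihilates it. -/
theorem exists_mul_eq_zero_of_ideal {I : Ideal (Mat n)} (hI : I ≠ ⊤) :
    ∃ B : Mat n, B ≠ 0 ∧ ∀ X ∈ I, X * B = 0 := by
  obtain ⟨e, he, rfl⟩ := IsSemisimpleRing.ideal_eq_span_idempotent I
  refine ⟨1 - e, fun h => hI ?_, fun X hX => ?_⟩
  · rw [← sub_eq_zero.1 h, Ideal.span_singleton_one]
  · obtain ⟨Y, rfl⟩ := Ideal.mem_span_singleton'.1 hX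
    rw [mul_assoc, mul_sub, mul_one, he.eq, sub_self, mul_zero]

theorem exists_right_annihilator (hS : S.QuasiregularTails) {J : Submodule ℂ B}
    (hJ : BanachAlg.IsLeftIdeal J) (hne : J ≠ ⊤) {e : B} (he : ∀ x, x - x * e ∈ J) :
    ∃ b : B, b ≠ 0 ∧ ∀ x ∈ J, x * b = 0 := by
  obtain ⟨n, X₀, hX₀⟩ := exists_block_notMem_of_isLeftIdeal hS hJ hne he
  let I : Ideal (Mat n) :=
    { carrier := {X | S.block n X ∈ J}
      add_mem' := fun {X Y} hX hY => by
        rw [Set.mem_ofPred_eq, S.block_add]; exact J.add_mem hX hY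
      zero_mem' := by rw [Set.mem_ofPred_eq, S.block_zero]; exact J.zero_mem
      smul_mem' := fun Y X hX => by
        have := hJ (S.block n Y) _ hX
        rwa [S.block_mul, S.co_block_self] at this }
  have hI : I ≠ ⊤ := fun h => hX₀ (show X₀ ∈ I from h ▸ Submodule.mem_top)
  obtain ⟨B, hB, hBI⟩ := exists_mul_eq_zero_of_ideal hI
  refine ⟨S.block n B, S.block_ne_zero hB, fun x hx => ?_⟩
  have h1 : S.co n x ∈ I := by
    have := hJ (S.block n 1) _ hx
    rwa [S.mul_block, one_mul] at this
  rw [S.block_mul, hBI _ h1, S.block_zero]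

theorem exists_left_annihilator (hS : S.QuasiregularTails) {J : Submodule ℂ B}
    (hJ : BanachAlg.IsRightIdeal J) (hne : J ≠ ⊤) {e : B} (he : ∀ x, x - e * x ∈ J) :
    ∃ b : B, b ≠ 0 ∧ ∀ x ∈ J, b * x = 0 := by
  obtain ⟨n, X₀, hX₀⟩ := exists_block_notMem_of_isRightIdeal hS hJ hne he
  -- Transposition turns the right ideal of matrices into a left ideal.
  let I : Ideal (Mat n) :=
    { carrier := {X | S.block n X.transpose ∈ J}
      add_mem' := fun {X Y} hX hY => by
        rw [Set.mem_ofPred_eq, Matrix.transpose_add, S.block_add]; exact J.add_mem hX hY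
      zero_mem' := by
        rw [Set.mem_ofPred_eq, Matrix.transpose_zero, S.block_zero]; exact J.zero_mem
      smul_mem' := fun Y X hX => by
        have := hJ (S.block n Y.transpose) _ hX
        rwa [S.block_mul, S.co_block_self, ← Matrix.transpose_mul] at this }
  have hI : I ≠ ⊤ := fun h => by
    have : X₀.transpose ∈ I := h ▸ Submodule.mem_top
    exact hX₀ (by simpa [I] using this)
  obtain ⟨B, hB, hBI⟩ := exists_mul_eq_zero_of_ideal hI
  refine ⟨S.block n B.transpose, S.block_ne_zero (by simpa using hB), fun x hx => ?_⟩
  have h1 : (S.co n x).transpose ∈ I := by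
    have := hJ (S.block n 1) _ hx
    rw [S.block_mul, mul_one] at this
    change S.block n (S.co n x).transpose.transpose ∈ J
    rwa [Matrix.transpose_transpose]
  have h2 := congrArg Matrix.transpose (hBI _ h1)
  rw [Matrix.transpose_mul, Matrix.transpose_transpose, Matrix.transpose_zero] at h2
  rw [S.mul_block, h2, S.block_zero]


theorem QuasiregularTails.isModularAnnihilator (hS : S.QuasiregularTails) :
    BanachAlg.IsModularAnnihilator B :=
  ⟨S.eq_zero_of_mul_mul_eq_zero,
    fun _ ⟨hJ, hne, _, _, he⟩ => exists_right_annihilator hS hJ hne he,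
    fun _ ⟨hJ, hne, _, _, he⟩ => exists_left_annihilator hS hJ hne he⟩

end Algebraic

end BlockSystem

/-! ### Failure of weak compactness -/

section Normed

variable {B : Type*} [NonUnitalNormedRing B] [NormedSpace ℂ B]

/-- Failure of weak compactness, for an algebra with coordinates in matrix algebras which contains
the sums of the initial blocks of the identity and an element `a` whose square does not vanish at
infinity. -/
theorem not_isWeaklyCompact_of_coords {f : ∀ n : ℕ+, B → Mat n}
    (hadd : ∀ n a b, f n (a + b) = f n a + f n b) (hsmul : ∀ n (r : ℂ) a, f n (r • a) = r • f n a)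
    (hmul : ∀ n a b, f n (a * b) = f n a * f n b)
    (hext : ∀ a b, (∀ n, f n a = f n b) → a = b) (hnorm : ∀ n a, ‖f n a‖ ≤ ‖a‖)
    (hq : ∀ m, ∃ q : B, ‖q‖ ≤ 1 ∧ (∀ n ≤ m, f n q = 1) ∧ ∀ n, m < n → f n q = 0)
    {a : B} {k : ℕ+} {ε : ℝ} (hε : 0 < ε) (ha : ∀ n ≥ k, ε ≤ ‖f n a * f n a‖) :
    ¬ BanachAlg.IsWeaklyCompact B := by
  intro hW
  let co : ∀ n : ℕ+, B →ₗ[ℂ] Mat n := fun n => ⟨⟨f n, hadd n⟩, hsmul n⟩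
  have co_mul : ∀ n (a b : B), co n (a * b) = co n a * co n b := hmul
  have co_ext : ∀ a b, (∀ n, co n a = co n b) → a = b := hext
  have hnorm : ∀ n a, ‖co n a‖ ≤ ‖a‖ := hnorm
  have ha : ∀ n ≥ k, ε ≤ ‖co n a * co n a‖ := ha
  have hq : ∀ m, ∃ q : B, ‖q‖ ≤ 1 ∧ (∀ n ≤ m, co n q = 1) ∧ ∀ n, m < n → co n q = 0 := hq
  clear_value co
  let entry : ∀ n : ℕ+, Fin n → Fin n → (B →L[ℂ] ℂ) := fun n i j =>
    LinearMap.mkContinuous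
      { toFun := fun a => co n a i j
        map_add' := fun a b => by rw [map_add, Matrix.add_apply]
        map_smul' := fun r a => by rw [map_smul, Matrix.smul_apply, RingHom.id_apply] } 1
      fun a => by
        rw [one_mul]
        exact (norm_entry_le _ i j).trans (hnorm n a)
  choose q hq1 hqone hqzero using hq
  let z : ℕ+ → WeakSpace ℂ B := fun m => toWeakSpace ℂ B (a * q m * a)
  have hz : ∀ m, z m ∈ closure ((fun x : B => toWeakSpace ℂ B (a * x * a)) ''
      Metric.closedBall (0 : B) 1) := fun m =>
    subset_closure ⟨q m, by simpa using hq1 m, rfl⟩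
  obtain ⟨w, -, hw⟩ := (hW a).exists_mapClusterPt (f := atTop) (u := z)
    (tendsto_principal.2 (Eventually.of_forall hz))
  obtain ⟨b, rfl⟩ := (toWeakSpace ℂ B).surjective w
  -- Matrix entries are weakly continuous and eventually constant along `z`, which identifies the
  -- cluster point.
  have hb : b = a * a := by
    refine co_ext _ _ fun n => ?_
    ext i j
    have hcont : Continuous fun y : WeakSpace ℂ B => entry n i j y :=
      WeakBilin.eval_continuous (topDualPairing ℂ B).flip (entry n i j)
    have h1 := hw.continuousAt_comp hcont.continuousAt
    have h2 : Tendsto ((fun y : WeakSpace ℂ B => entry n i j y) ∘ z) atTop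
        (𝓝 (co n (a * a) i j)) := by
      refine tendsto_const_nhds.congr' (eventually_atTop.2 ⟨n, fun m hm => ?_⟩)
      change _ = co n (a * q m * a) i j
      rw [co_mul, co_mul, co_mul, hqone m n hm, mul_one]
    exact eq_of_nhds_neBot (ClusterPt.mono h1 h2)
  let s : Set B := {x | ∃ m, ∀ n ≥ m, co n x = 0}
  have hs : Convex ℝ s := by
    rintro x ⟨m, hm⟩ y ⟨m', hm'⟩ r r' _ _ _
    refine ⟨max m m', fun n hn => ?_⟩
    have e : r • x + r' • y = (r : ℂ) • x + (r' : ℂ) • y := by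
      rw [Complex.coe_smul, Complex.coe_smul]
    rw [e, map_add, map_smul, map_smul, hm n ((le_max_left _ _).trans hn),
      hm' n ((le_max_right _ _).trans hn), smul_zero, smul_zero, add_zero]
  have hzs : ∀ m, z m ∈ toWeakSpace ℂ B '' s := fun m => by
    refine ⟨_, ⟨m + 1, fun n hn => ?_⟩, rfl⟩
    have : co n (q m) = 0 := hqzero m n (PNat.add_one_le_iff.1 hn)
    rw [co_mul, co_mul, this, mul_zero, zero_mul]
  have hbs : toWeakSpace ℂ B b ∈ closure (toWeakSpace ℂ B '' s) := by
    rw [mem_closure_iff_clusterPt]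
    exact ClusterPt.mono hw (tendsto_principal.2 (Eventually.of_forall hzs))
  -- Mazur: a convex set has the same weak and norm closures.
  rw [← hs.toWeakSpace_closure ℂ] at hbs
  obtain ⟨b', hb', hbb'⟩ := hbs
  rw [(toWeakSpace ℂ B).injective hbb', hb] at hb'
  obtain ⟨x, ⟨m, hm⟩, hx⟩ := Metric.mem_closure_iff.1 hb' ε hε
  have hn := hnorm (max m k) (a * a - x)
  rw [map_sub, hm _ (le_max_left _ _), sub_zero, co_mul] at hn
  have := ha (max m k) (le_max_right _ _)
  rw [dist_eq_norm] at hx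
  linarith

end Normed

/-- The sum of the entries of a matrix. -/
def entrySum (n : ℕ+) : Mat n →ₗ[ℂ] ℂ where
  toFun X := ∑ i, ∑ j, X i j
  map_add' X Y := by simp [Finset.sum_add_distrib]
  map_smul' r X := by simp [Finset.mul_sum]

/-- The truncated subtraction is intended: the power vanishes once `m ≥ n`. -/
theorem entrySum_shift_pow (m : ℕ) : entrySum n (shift n ^ m) = (((n : ℕ) - m : ℕ) : ℂ) := by
  change ∑ i : Fin n, ∑ j : Fin n, (shift n ^ m) i j = _
  have h1 : ∀ i : Fin n, ∑ j : Fin n, (shift n ^ m) i j = if (i : ℕ) + m < n then 1 else 0 := by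
    intro i
    simp_rw [shift_pow_apply]
    split_ifs with h
    · rw [Finset.sum_eq_single ⟨(i : ℕ) + m, h⟩]
      · simp
      · intro j _ hj
        exact if_neg fun h' => hj (Fin.ext h'.symm)
      · simp
    · exact Finset.sum_eq_zero fun j _ => if_neg (by omega)
  simp_rw [h1]
  rw [Fin.sum_univ_eq_sum_range (fun i => if i + m < n then (1 : ℂ) else 0) n, Finset.sum_boole]
  congr 1
  have : (Finset.range (n : ℕ)).filter (fun i => i + m < n) = Finset.range ((n : ℕ) - m) := by
    ext i; simp; omega
  rw [this, Finset.card_range]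

/-- For `k ≥ 8` the exponents are at most `n/4`, so every power in the expanded square has at least
`n/2` unit entries; the bound by `n` times the norm then gives `1/2`. -/
theorem half_le_norm_powAvg_sq {k : ℕ+} (h8 : 8 ≤ k) (hk : k ≤ n) :
    1 / 2 ≤ ‖BanachAlg.powAvg (shift n) (E n k) * BanachAlg.powAvg (shift n) (E n k)‖ := by
  set s := E n k with hs
  have hc0 : (0 : ℝ) < s.card := by exact_mod_cast (E_nonempty hk).card_pos
  have hn0 : (0 : ℝ) < n := by exact_mod_cast n.pos
  have e : entrySum n (BanachAlg.powAvg (shift n) s * BanachAlg.powAvg (shift n) s) =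
      (((s.card : ℝ)⁻¹ * ((s.card : ℝ)⁻¹ *
        ∑ i ∈ s, ∑ j ∈ s, (((n : ℕ) - (i + j) : ℕ) : ℝ)) : ℝ) : ℂ) := by
    rw [BanachAlg.powAvg, smul_mul_smul_comm, Finset.sum_mul_sum]
    simp_rw [← pow_add, map_smul, map_sum, entrySum_shift_pow]
    push_cast
    rw [smul_eq_mul, mul_assoc]
  have hterm : ∀ i ∈ s, ∀ j ∈ s, (n : ℝ) / 2 ≤ (((n : ℕ) - (i + j) : ℕ) : ℝ) := by
    intro i hi j hj
    have h1 := mul_le_of_mem_E hi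
    have h2 := mul_le_of_mem_E hj
    have h8' : 8 ≤ (k : ℕ) := h8
    have h3 : i * 8 ≤ 2 * (n : ℕ) := (Nat.mul_le_mul_left _ h8').trans h1
    have h4 : j * 8 ≤ 2 * (n : ℕ) := (Nat.mul_le_mul_left _ h8').trans h2
    have h5 : (n : ℕ) ≤ 2 * ((n : ℕ) - (i + j)) := by omega
    have h6 : (n : ℝ) ≤ 2 * (((n : ℕ) - (i + j) : ℕ) : ℝ) := by exact_mod_cast h5
    linarith
  have hsum : (s.card : ℝ) * (s.card * ((n : ℝ) / 2)) ≤
      ∑ i ∈ s, ∑ j ∈ s, (((n : ℕ) - (i + j) : ℕ) : ℝ) := by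
    rw [← nsmul_eq_mul, ← nsmul_eq_mul]
    exact Finset.card_nsmul_le_sum _ _ _ fun i hi => Finset.card_nsmul_le_sum _ _ _ (hterm i hi)
  have hle := norm_sum_entries_le
    (BanachAlg.powAvg (shift n) s * BanachAlg.powAvg (shift n) s)
  change ‖entrySum n _‖ ≤ _ at hle
  rw [e, Complex.norm_real] at hle
  have hle2 := (le_abs_self _).trans hle
  have hle3 : (n : ℝ) / 2 ≤ (s.card : ℝ)⁻¹ * ((s.card : ℝ)⁻¹ *
      ∑ i ∈ s, ∑ j ∈ s, (((n : ℕ) - (i + j) : ℕ) : ℝ)) := by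
    rw [le_inv_mul_iff₀ hc0, le_inv_mul_iff₀ hc0]
    exact hsum
  have hle4 : (n : ℝ) * (1 / 2) ≤ n * ‖BanachAlg.powAvg (shift n) s *
      BanachAlg.powAvg (shift n) s‖ := by linarith [hle3.trans hle2]
  exact le_of_mul_le_mul_left hle4 hn0

end ShiftAlg

namespace ShiftAlg

variable {c : ℕ+ → ℝ} {n : ℕ+}

/-! ### The representation by blocks -/

/-- The element of the algebra with `n`-th coordinate `(X, d X d⁻¹)` and all others zero. -/
noncomputable def block (hpos : ∀ n, 0 < c n) (n : ℕ+) (X : Mat n) : A c :=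
  ⟨lp.single (E := fun n => Mat n × Mat n) ∞ n (X, d c n * X * (d c n)⁻¹), by
    refine mem_A_of_support hpos (n₀ := n + 1) (fun m => ?_) fun m hm => ?_
    · by_cases h : m = n
      · subst h; rw [lp.single_apply_self]
      · rw [lp.single_apply_ne _ _ _ h]; simp
    · exact lp.single_apply_ne _ _ _ (PNat.add_one_le_iff.1 hm).ne'⟩

theorem fst_block_self (hpos : ∀ n, 0 < c n) (n : ℕ+) (X : Mat n) :
    ((block hpos n X : M) n).1 = X :=
  congrArg Prod.fst
    (lp.single_apply_self (E := fun n => Mat n × Mat n) ∞ n (X, d c n * X * (d c n)⁻¹))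

theorem fst_block_ne (hpos : ∀ n, 0 < c n) (m n : ℕ+) (h : m ≠ n) (X : Mat n) :
    ((block hpos n X : M) m).1 = 0 :=
  congrArg Prod.fst
    (lp.single_apply_ne (E := fun n => Mat n × Mat n) ∞ n (X, d c n * X * (d c n)⁻¹) h)

theorem ext_fst {a b : A c} (h : ∀ n, ((a : M) n).1 = ((b : M) n).1) : a = b := by
  refine Subtype.ext (lp.ext (funext fun n => Prod.ext (h n) ?_))
  rw [a.2.1 n, b.2.1 n, h n]

/-- The first components of the coordinates represent the algebra by sequences of matrices. -/
noncomputable def blockSystem (hpos : ∀ n, 0 < c n) : BlockSystem (A c) :=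
  BlockSystem.ofFun (fun n a => ((a : M) n).1) (fun _ _ _ => rfl) (fun _ _ _ => rfl)
    (fun _ _ _ => rfl) (fun _ _ => ext_fst) (block hpos) (fst_block_self hpos) (fst_block_ne hpos)

/-- The cut is made where the second components drop below `1/2`; below it the tail is zero. -/
theorem quasiregularTails (hpos : ∀ n, 0 < c n) (htop : Tendsto c atTop atTop) :
    (blockSystem hpos).QuasiregularTails := fun e => by
  obtain ⟨n₀, hn₀⟩ := eventually_atTop.1 (htop.eventually_ge_atTop 2)
  obtain ⟨n₁, hn₁⟩ := exists_norm_snd_le hn₀ e.2 (ε := 1 / 2) (by norm_num)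
  refine ⟨n₁, fun t h1 h2 => ?_⟩
  refine isQuasiregular_of_norm_lt hpos htop _ (n₁ := n₁) (fun n hn => ?_) fun n hn => ?_
  · change ‖-((t : M) n).2‖ < 1
    have h3 : ((t : M) n).1 = ((e : M) n).1 := h2 n hn
    rw [norm_neg, t.2.1 n, h3, ← e.2.1 n]
    linarith [hn₁ n hn]
  · change IsUnit (1 + -((t : M) n).1)
    have h3 : ((t : M) n).1 = 0 := h1 n hn
    rw [h3, neg_zero, add_zero]
    exact isUnit_one

/-- Beyond `n₁` the second components have norm at most `δ/2`, so such a `z` must be an eigenvalue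
of one of the finitely many earlier blocks. -/
theorem finite_quasispectrum_ge (hpos : ∀ n, 0 < c n) (htop : Tendsto c atTop atTop) (a : A c)
    {δ : ℝ} (hδ : 0 < δ) : {z ∈ quasispectrum ℂ a | δ ≤ ‖z‖}.Finite := by
  obtain ⟨n₀, hn₀⟩ := eventually_atTop.1 (htop.eventually_ge_atTop 2)
  obtain ⟨n₁, hn₁⟩ := exists_norm_snd_le hn₀ a.2 (half_pos hδ)
  refine ((Finset.Iio n₁).finite_toSet.biUnion fun n _ =>
    Matrix.finite_spectrum ((a : M) n).1).subset ?_
  rintro z ⟨hz, hzδ⟩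
  by_contra hcon
  have hz0 : z ≠ 0 := norm_pos_iff.1 (hδ.trans_le hzδ)
  refine hz (isUnit_iff_ne_zero.2 hz0) ?_
  have e : ((isUnit_iff_ne_zero.2 hz0).unit⁻¹ : ℂˣ).val = z⁻¹ := by simp
  refine isQuasiregular_of_norm_lt hpos htop _ (n₁ := n₁) (fun n hn => ?_) fun n hn => ?_
  · change ‖-(((isUnit_iff_ne_zero.2 hz0).unit⁻¹ : ℂˣ).val • ((a : M) n).2)‖ < 1
    rw [e, norm_neg, norm_smul, norm_inv, inv_mul_lt_iff₀ (hδ.trans_le hzδ)]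
    linarith [hn₁ n hn]
  · change IsUnit (1 + -(((isUnit_iff_ne_zero.2 hz0).unit⁻¹ : ℂˣ).val • ((a : M) n).1))
    have hns : z ∉ spectrum ℂ ((a : M) n).1 := fun h =>
      hcon (Set.mem_biUnion (by simpa using hn) h)
    rw [spectrum.notMem_iff] at hns
    have e2 : 1 + -(z⁻¹ • ((a : M) n).1) =
        (Units.mk0 z hz0)⁻¹ • (algebraMap ℂ (Mat n) z - ((a : M) n).1) := by
      rw [Units.smul_def, smul_sub, Algebra.algebraMap_eq_smul_one, smul_smul]
      simp [hz0, sub_eq_add_neg]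
    rw [e, e2]
    exact hns.smul _

theorem isApproximatelyUnital (hpos : ∀ n, 0 < c n) {n₀ : ℕ+} (h : ∀ n ≥ n₀, 1 ≤ c n) :
    BanachAlg.IsApproximatelyUnital (A c) := by
  have hex : ∀ k : ℕ+, ∃ a : A c, n₀ ≤ k → ‖a‖ ≤ 1 ∧ ∀ n, (a : M) n = U c k n := fun k => by
    by_cases hk : n₀ ≤ k
    · obtain ⟨a, ha⟩ := exists_U_mem_A hpos h hk
      exact ⟨a, fun _ => ha⟩
    · exact ⟨⟨0, (A c).zero_mem'⟩, fun h' => absurd h' hk⟩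
  choose v hv using hex
  refine BanachAlg.isApproximatelyUnital_of_seq (v := v) (fun k hk => (hv k hk).1) fun a ε hε => ?_
  obtain ⟨k₀, hk₀⟩ := (mem_A_iff.1 a.2).2 ε hε
  refine ⟨max k₀ n₀, fun k hk => ⟨?_, ?_⟩⟩
  · refine lp.norm_le_of_forall_le hε.le fun n => ?_
    have := (hk₀ k ((le_max_left _ _).trans hk) n).1
    rwa [← (hv k ((le_max_right _ _).trans hk)).2 n] at this
  · refine lp.norm_le_of_forall_le hε.le fun n => ?_
    have := (hk₀ k ((le_max_left _ _).trans hk) n).2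
    rwa [← (hv k ((le_max_right _ _).trans hk)).2 n] at this

theorem exists_initial_unit (hpos : ∀ n, 0 < c n) (m : ℕ+) : ∃ q : A c, ‖q‖ ≤ 1 ∧
    (∀ n ≤ m, ((q : M) n).1 = 1) ∧ ∀ n, m < n → ((q : M) n).1 = 0 := by
  let f : ∀ n : ℕ+, Mat n × Mat n := fun n => if n ≤ m then 1 else 0
  have hf : ∀ n, ‖f n‖ ≤ 1 := fun n => by
    simp only [f]
    split_ifs
    · exact norm_one_prod_le
    · simp
  let q : M := ⟨f, memℓp_infty ⟨1, by rintro _ ⟨n, rfl⟩; exact hf n⟩⟩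
  have hq0 : ∀ n, m < n → q n = 0 := fun n hn => if_neg (not_le.2 hn)
  have hq1 : ∀ n ≤ m, q n = 1 := fun n hn => if_pos hn
  have hqA : q ∈ A c := by
    refine mem_A_of_support hpos (n₀ := m + 1) (fun n => ?_) fun n hn =>
      hq0 n (PNat.add_one_le_iff.1 hn)
    rcases le_or_gt n m with hn | hn
    · rw [hq1 n hn, Prod.snd_one, Prod.fst_one, d_conj_one (hpos n)]
    · rw [hq0 n hn]; simp
  exact ⟨⟨q, hqA⟩, lp.norm_le_of_forall_le zero_le_one hf,
    fun n hn => congrArg Prod.fst (hq1 n hn), fun n hn => congrArg Prod.fst (hq0 n hn)⟩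

theorem not_isWeaklyCompact (hpos : ∀ n, 0 < c n) {n₀ : ℕ+} (h : ∀ n ≥ n₀, 1 ≤ c n) :
    ¬ BanachAlg.IsWeaklyCompact (A c) := by
  obtain ⟨a, -, ha⟩ := exists_U_mem_A hpos h (le_max_left n₀ 8)
  refine not_isWeaklyCompact_of_coords (f := fun n b => ((b : M) n).1) (fun _ _ _ => rfl)
    (fun _ _ _ => rfl) (fun _ _ _ => rfl) (fun _ _ => ext_fst)
    (fun n b => (norm_prod_le_iff.1 (norm_apply_le (b : M) n)).1) (exists_initial_unit hpos)
    (a := a) (k := max n₀ 8) (ε := 1 / 2) (by norm_num) fun n hn => ?_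
  have hu : ((a : M) n).1 = BanachAlg.powAvg (shift n) (E n (max n₀ 8)) := by
    rw [ha, U, u, if_pos hn]
    rfl
  rw [hu]
  exact half_le_norm_powAvg_sq (le_max_right n₀ 8) hn

end ShiftAlg

theorem mainTheorem2 (c : ℕ+ → ℝ) (hpos : ∀ n, 0 < c n) (hmono : Monotone c)
    (hunb : ¬ BddAbove (Set.range c)) :
    IsClosed (ShiftAlg.A c : Set ShiftAlg.M) ∧
    (∀ a : ShiftAlg.A c, (quasispectrum ℂ a).Finite ∨
      ∃ l : ℕ → ℂ, Tendsto l atTop (𝓝 0) ∧ quasispectrum ℂ a = insert 0 (Set.range l)) ∧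
    BanachAlg.IsSemisimple (ShiftAlg.A c) ∧
    BanachAlg.IsApproximatelyUnital (ShiftAlg.A c) ∧
    BanachAlg.IsModularAnnihilator (ShiftAlg.A c) ∧
    ¬ BanachAlg.IsWeaklyCompact (ShiftAlg.A c) := by
  have htop : Tendsto c atTop atTop := by
    refine tendsto_atTop_atTop_of_monotone hmono fun b => ?_
    by_contra! hcon
    exact hunb ⟨b, by rintro _ ⟨n, rfl⟩; exact (hcon n).le⟩
  obtain ⟨n₀, hn₀⟩ := eventually_atTop.1 (htop.eventually_ge_atTop 1)
  exact ⟨ShiftAlg.isClosed_A hpos hn₀,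
    fun a => Set.finite_or_eq_insert_zero_range (quasispectrum.zero_mem ℂ a) fun _ hδ =>
      ShiftAlg.finite_quasispectrum_ge hpos htop a hδ,
    (ShiftAlg.blockSystem hpos).isSemisimple,
    ShiftAlg.isApproximatelyUnital hpos hn₀,
    (ShiftAlg.quasiregularTails hpos htop).isModularAnnihilator,
    ShiftAlg.not_isWeaklyCompact hpos hn₀⟩
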